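/- Let $\mathbb X\subseteq\mathbb R^d$, $\mathbb Y=\{+1,-1\}$, let $Q$ be a probability distribution on $\mathbb X\times\mathbb Y$ with input marginal $Q_X$, and write $\|g\|_Q^2=\int g^2\,dQ_X$. Let $(\Theta,\Delta)$ be a metric space and $\mathcal F_0=\{f_\theta:\mathbb X\to[-1,1]\mid\theta\in\Theta\}$ a class of measurable functions that contains the regression function $f^*(x)=\mathbb E[Y\mid X=x]$, say $f^*=f_{\theta^*}$ ($Q_X$-a.s.). Assume that $\|f_{\theta_1}-f_{\theta_2}\|_Q\neq0$ whenever $\theta_1\ne\theta_2$; that for some $L>0$, $\Delta(\theta_1,\theta_2)\le L\,\|f_{\theta_1}-f_{\theta_2}\|_Q$ for all $\theta_1,\theta_2\in\Theta$; and that the pseudo-dimension $V$ of $\mathcal F_0$ (the VC dimension of the class of subgraphs $\{(x,t)\mid t\le f(x)\}$, $f\in\mathcal F_0$) is finite. Assume moreover that for every $n$ and every data set $D\in(\mathbb X\times\mathbb Y)^n$ a minimizer $\hat f_D\in\mathcal F_0$ of the empirical risk $\frac1n\sum_{(x,y)\in D}(f(x)-y)^2$ over $f\in\mathcal F_0$ exists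 and is chosen so that $(D,x)\mapsto\hat f_D(x)$ is measurable, and that suprema over the class are measurable: for every $n$, all bounded measurable $\varphi_1,\dots,\varphi_n$ and every i.i.d. sample $(X_i,V_i)_{i\le n}$ with $X_i\sim Q_X$ and real $V_i$, the supremum $\sup_{f,g\in\mathcal F_0}\big|\sum_{i=1}^n\varphi_i(f(X_i),g(X_i),X_i,V_i)\big|$ is measurable up to null sets. Let $q<m$ be integers, $m\ge 1$. For a sample size $n$, let $\mathcal D_0=\{(X_i,Y_i)\}_{i=1}^n$ be i.i.d. from $Q$, let $U_{i,j}$ ($1\le i\le n$, $1\le j\le m-1$) be i.i.d. uniform on $[-1,1]$ and $\pi$ a uniformly random permutation of $\{1,\dots,m\}$, with $\mathcal D_0$, $(U_{i,j})$ and $\pi$ independent. For $\theta\in\Theta$ put $\mathcal D_0(\theta)=\mathcal D_0$ and $\mathcal D_j(\theta)=\{(X_i,\operatorname{sign}(f_\theta(X_i)+U_{i,j}))\}_{i=1}^n$ for $1\le j\le m-1$, where $\operatorname{sign}(0)=+1$, and for $0\le j\le m-1$ $$Z_n^{(j)}(\theta)=\frac1n\sum_{i=1}^n\big(f_\theta(X_i)-\hat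 f_{\mathcal D_j(\theta)}(X_i)\big)^2 .$$ Let $\Theta_n^{(1)}$ be the set of all $\theta\in\Theta$ for which the rank $$1+\#\big\{1\le j\le m-1:\ Z_n^{(j)}(\theta)<Z_n^{(0)}(\theta),\ \text{or}\ Z_n^{(j)}(\theta)=Z_n^{(0)}(\theta)\ \text{and}\ \pi(j)<\pi(m)\big\}$$ is at most $q$. Then for every $\varepsilon>0$ there is $N_0$ such that for all $n\ge N_0$ $$\mathbb P\big(\Theta_n^{(1)}\subseteq B(\theta^*,\varepsilon)\big)\ \ge\ 1-C_1e^{-n\lambda_1},$$ where $B(\theta^*,\varepsilon)=\{\theta\in\Theta\mid\Delta(\theta,\theta^*)<\varepsilon\}$. Here $C_1$ depends only on $\varepsilon$ and $V$, and $\lambda_1>0$ depends only on $\varepsilon$ and $L$. If the event is not measurable, the bound is meant in the strong sense that its complement has outer probability at most $C_1e^{-n\lambda_1}$. -/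

import Mathlib

open MeasureTheory ProbabilityTheory

universe u v

namespace ERMRegion

noncomputable section

/-- The binary output space `{+1, -1}`, as a subset of the reals. -/
abbrev Label : Type := ↥({1, -1} : Set ℝ)

/-- The sign of a real number as an output, with the convention `sign 0 = +1`. -/
def signLabel (z : ℝ) : Label :=
  if 0 ≤ z then ⟨1, by simp⟩ else ⟨-1, by simp⟩

/-- A class `A` of subsets of `α` shatters the finite set `C`. -/
def ClassShatters {α : Type u} (A : Set (Set α)) (C : Finset α) : Prop :=
  ∀ C₀ : Set α, C₀ ⊆ (C : Set α) → ∃ a ∈ A, a ∩ (C : Set α) = C₀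

/-- The Vapnik-Chervonenkis dimension: the largest cardinality of a shattered finite set
(`⊤` if there is no largest one). -/
def classVCDim {α : Type u} (A : Set (Set α)) : ℕ∞ :=
  ⨆ (C : Finset α) (_ : ClassShatters A C), (C.card : ℕ∞)

/-- The subgraph `{(x, t) | t ≤ h x}`. -/
def subgraph {𝕏 : Type u} (h : 𝕏 → ℝ) : Set (𝕏 × ℝ) := {p | p.2 ≤ h p.1}

/-- The pseudo-dimension of a class of real functions: the VC dimension of its subgraphs. -/
def pseudoDim {𝕏 : Type u} (H : Set (𝕏 → ℝ)) : ℕ∞ := classVCDim (subgraph '' H)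

/-- The `L₂` distance of two functions with respect to the input distribution `μ`. -/
def l2dist {𝕏 : Type u} [MeasurableSpace 𝕏] (μ : Measure 𝕏) (g h : 𝕏 → ℝ) : ℝ :=
  Real.sqrt (∫ x, (g x - h x) ^ 2 ∂μ)

/-- `g` is (a version of) the regression function `x ↦ E[Y | X = x]` of `(X, Y) ∼ Q`. -/
def IsRegressionFunction {𝕏 : Type u} [MeasurableSpace 𝕏] (Q : Measure (𝕏 × Label))
    (g : 𝕏 → ℝ) : Prop :=
  Measurable g ∧
    Q[fun p : 𝕏 × Label => (p.2 : ℝ) | MeasurableSpace.comap Prod.fst inferInstance]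
      =ᵐ[Q] fun p => g p.1

/-- The empirical (squared) risk of `g` on the data set `D`. -/
def empRisk {𝕏 : Type u} {n : ℕ} (D : Fin n → 𝕏 × Label) (g : 𝕏 → ℝ) : ℝ :=
  (1 / (n : ℝ)) * ∑ i, (g (D i).1 - ((D i).2 : ℝ)) ^ 2

/-- `est` is an empirical risk minimizer over `{f θ | θ}`: for every sample size `n` and every data
set `D` the function `f (est n D)` minimizes the empirical risk on `D` over the class, and it
depends measurably on the data. Minimizers need not be unique. -/
def IsERM {𝕏 : Type u} [MeasurableSpace 𝕏] {Θ : Type v} (f : Θ → 𝕏 → ℝ)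
    (est : (n : ℕ) → (Fin n → 𝕏 × Label) → Θ) : Prop :=
  ∀ n : ℕ, (∀ (D : Fin n → 𝕏 × Label) (θ : Θ), empRisk D (f (est n D)) ≤ empRisk D (f θ)) ∧
    Measurable fun p : (Fin n → 𝕏 × Label) × 𝕏 => f (est n p.1) p.2

/-- Suprema over the class of absolute values of sums of bounded measurable functions of the
evaluations, taken on an i.i.d. sample `(X₁, V₁), …, (Xₙ, Vₙ)` with `Xᵢ ∼ μ` and with arbitrary
real marks `Vᵢ`, are measurable (up to null sets). -/
def MeasurableSuprema {𝕏 : Type u} [MeasurableSpace 𝕏] {Θ : Type v} (μ : Measure 𝕏)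
    (f : Θ → 𝕏 → ℝ) : Prop :=
  ∀ ρ : Measure (𝕏 × ℝ), IsProbabilityMeasure ρ → ρ.fst = μ →
    ∀ (n : ℕ) (φ : Fin n → ℝ × ℝ × 𝕏 × ℝ → ℝ),
      (∀ i, Measurable (φ i)) → (∃ M : ℝ, ∀ i z, |φ i z| ≤ M) →
      AEMeasurable
        (fun z : Fin n → 𝕏 × ℝ =>
          ⨆ p : Θ × Θ, |∑ i, φ i (f p.1 (z i).1, f p.2 (z i).1, (z i).1, (z i).2)|)
        (Measure.pi fun _ => ρ)

/-- The discrete measurable structure on the permutations of a finite set. -/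
instance permMeasurableSpace (m : ℕ) : MeasurableSpace (Equiv.Perm (Fin m)) := ⊤

/-- The joint law of all the randomness of the method for sample size `n` and `r` alternative
samples: the sample `D₀` is i.i.d. from `Q`, the variables `U i j` are i.i.d. uniform on `[-1, 1]`,
the permutation of the `m = r + 1` data sets is uniform, and the three are independent. -/
def jointLaw {𝕏 : Type u} [MeasurableSpace 𝕏] (Q : Measure (𝕏 × Label)) (n r : ℕ) :
    Measure ((Fin n → 𝕏 × Label) × (Fin n × Fin r → ℝ) × Equiv.Perm (Fin (r + 1))) :=
  (Measure.pi fun _ : Fin n => Q).prod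
    ((Measure.pi fun _ : Fin n × Fin r =>
        ProbabilityTheory.cond (volume : Measure ℝ) (Set.Icc (-1) 1)).prod
      (uniformOn (Set.univ : Set (Equiv.Perm (Fin (r + 1))))))

/-- The alternative sample of the candidate `g`: the inputs of `D` with outputs
`sign (g (Xᵢ) + uᵢ)`. -/
def altSample {𝕏 : Type u} {n : ℕ} (g : 𝕏 → ℝ) (D : Fin n → 𝕏 × Label) (w : Fin n → ℝ) :
    Fin n → 𝕏 × Label :=
  fun i => ((D i).1, signLabel (g (D i).1 + w i))

/-- The reference variable of the candidate `θ` on the data set `D`: the empirical squared distance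
of `f θ` from the empirical risk minimizer of `D`. -/
def refVar {𝕏 : Type u} {Θ : Type v} {n : ℕ} (f : Θ → 𝕏 → ℝ)
    (est : (n : ℕ) → (Fin n → 𝕏 × Label) → Θ) (θ : Θ) (D : Fin n → 𝕏 × Label) : ℝ :=
  (1 / (n : ℝ)) * ∑ i, (f θ (D i).1 - f (est n D) (D i).1) ^ 2

open Classical in
/-- The rank of the reference variable of the original sample among those of all `m = r + 1`
samples. Ties are broken by the permutation `π`: the original sample carries the value of `π` at
the last index, the `j`-th alternative sample its value at `j`. -/
def rank {𝕏 : Type u} {Θ : Type v} {n r : ℕ} (f : Θ → 𝕏 → ℝ)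
    (est : (n : ℕ) → (Fin n → 𝕏 × Label) → Θ) (D : Fin n → 𝕏 × Label)
    (U : Fin n × Fin r → ℝ) (π : Equiv.Perm (Fin (r + 1))) (θ : Θ) : ℕ :=
  1 + ∑ j : Fin r,
    if refVar f est θ (altSample (f θ) D fun i => U (i, j)) < refVar f est θ D ∨
        (refVar f est θ (altSample (f θ) D fun i => U (i, j)) = refVar f est θ D ∧
          π j.castSucc < π (Fin.last r))
    then 1 else 0

/-- The confidence region: the parameters of rank at most `q`. -/
def region {𝕏 : Type u} {Θ : Type v} {n r : ℕ} (f : Θ → 𝕏 → ℝ)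
    (est : (n : ℕ) → (Fin n → 𝕏 × Label) → Θ) (q : ℕ) (D : Fin n → 𝕏 × Label)
    (U : Fin n × Fin r → ℝ) (π : Equiv.Perm (Fin (r + 1))) : Set Θ :=
  {θ | rank f est D U π θ ≤ q}

end

end ERMRegion

namespace ERMRegion

open scoped ENNReal
open Filter Topology

/-! Put t = ε²/(10L²). Since the minimizer f̂ does no worse on its data than f_θ, expanding squares
bounds the reference variable by twice the absolute average of (y - f_θ)(f̂ - f_θ)
(`refVar_le_two_mul_abs`). If f_θ is the regression function of the data, this product has mean zero
for every fixed function in place of f̂, so a uniform law of large numbers makes the reference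
variable at most 2t. This covers the original sample at θ* and, because sign(a + U) has mean a for
|a| ≤ 1, every alternative sample for all θ at once. If θ is outside the ball, the squared distance
of f_θ to f* is at least 10t, its empirical version at least 9t, and the original reference variable
at least 9t/2 - 2t = 5t/2 > 2t. Hence θ gets rank m > q (`rank_eq_of_notMem_deviationEvent`).

The uniform law (`eventually_pi_pairLoss_deviation_le`) runs over pairs of parameters because f̂
depends on the data. Its proof uses a ghost sample, random swaps, Hoeffding's inequality and
empirical covers from the Sauer-Shelah bound. The alternative outputs jump as f_θ(x) crosses -v, but
membership of (x, -v) in the subgraph decides the side, so finite pseudo-dimension controls the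
jumps too. -/

/-! ### Hoeffding's inequality for random signs -/

theorem sum_exp_signed_sum (n : ℕ) (a : Fin n → ℝ) :
    ∑ s : Fin n → Bool, Real.exp (∑ i, (if s i then a i else -a i)) =
      ∏ i, (2 * Real.cosh (a i)) := by
  have h := Finset.prod_univ_sum (fun _ : Fin n => (Finset.univ : Finset Bool))
    (fun i b => Real.exp (if b then a i else -a i))
  rw [Fintype.piFinset_univ] at h
  simp_rw [Real.exp_sum]
  rw [← h]
  refine Finset.prod_congr rfl fun i _ => ?_
  simp [Real.cosh_eq]
  ring

/-- Summing over all sign patterns factors the exponential moment into hyperbolic cosines, and cosh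
u ≤ exp(u²/2). -/
theorem sum_exp_signed_sum_le {n : ℕ} {a : Fin n → ℝ} {c : ℝ} (ha : ∀ i, |a i| ≤ c) (l : ℝ) :
    ∑ s : Fin n → Bool, Real.exp (l * ∑ i, (if s i then a i else -a i)) ≤
      2 ^ n * Real.exp (n * (l ^ 2 * c ^ 2 / 2)) := by
  have h := sum_exp_signed_sum n (fun i => l * a i)
  have h2 : ∀ s : Fin n → Bool, l * ∑ i, (if s i then a i else -a i) =
      ∑ i, (if s i then l * a i else -(l * a i)) := by
    intro s
    rw [Finset.mul_sum]
    refine Finset.sum_congr rfl fun i _ => ?_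
    split_ifs <;> ring
  simp_rw [h2, h]
  calc ∏ i, (2 * Real.cosh (l * a i)) ≤ ∏ _i : Fin n, (2 * Real.exp (l ^ 2 * c ^ 2 / 2)) := by
        refine Finset.prod_le_prod (fun i _ => by positivity) fun i _ => ?_
        refine mul_le_mul_of_nonneg_left ((Real.cosh_le_exp_half_sq _).trans ?_) two_pos.le
        have : a i ^ 2 ≤ c ^ 2 := sq_le_sq' (abs_le.1 (ha i)).1 (abs_le.1 (ha i)).2
        rw [mul_pow]
        gcongr
    _ = 2 ^ n * Real.exp (n * (l ^ 2 * c ^ 2 / 2)) := by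
        simp [Finset.prod_const, mul_pow, ← Real.exp_nat_mul]

/-- Hoeffding's inequality for Rademacher sums, in counting form. -/
theorem card_signed_sum_gt_le {n : ℕ} {a : Fin n → ℝ} {c : ℝ} (hc : 0 < c) (ha : ∀ i, |a i| ≤ c)
    {s : ℝ} (hs : 0 < s) :
    ((Finset.univ.filter fun e : Fin n → Bool =>
        n * s < |∑ i, (if e i then a i else -a i)|).card : ℝ) ≤
      2 ^ n * (2 * Real.exp (-n * s ^ 2 / (2 * c ^ 2))) := by
  -- The minimizer of the Chernoff exponent -l s + l² c²/2.
  set l := s / c ^ 2 with hl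
  have hl0 : 0 < l := by positivity
  set T : (Fin n → Bool) → ℝ := fun e => ∑ i, (if e i then a i else -a i) with hT
  have h1 := sum_exp_signed_sum_le ha l
  have h2 := sum_exp_signed_sum_le ha (-l)
  have key : ((Finset.univ.filter fun e : Fin n → Bool => n * s < |T e|).card : ℝ) *
      Real.exp (l * (n * s)) ≤ ∑ e, (Real.exp (l * T e) + Real.exp (-l * T e)) := by
    rw [← nsmul_eq_mul, ← Finset.sum_const]
    refine (Finset.sum_le_sum (g := fun e => Real.exp (l * T e) + Real.exp (-l * T e)) ?_).trans
      (Finset.sum_le_sum_of_subset_of_nonneg (Finset.filter_subset _ _)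
        fun e _ _ => by positivity)
    intro e he
    have he' : n * s < |T e| := (Finset.mem_filter.1 he).2
    rcases lt_abs.1 he' with h | h
    · have : Real.exp (l * (n * s)) ≤ Real.exp (l * T e) := by gcongr
      have := Real.exp_pos (-l * T e)
      linarith
    · have : Real.exp (l * (n * s)) ≤ Real.exp (-l * T e) := by
        rw [neg_mul, ← mul_neg]; gcongr
      have := Real.exp_pos (l * T e)
      linarith
  rw [Finset.sum_add_distrib] at key
  have h3 : ((Finset.univ.filter fun e : Fin n → Bool => n * s < |T e|).card : ℝ) *
      Real.exp (l * (n * s)) ≤ 2 ^ n * (2 * Real.exp (n * (l ^ 2 * c ^ 2 / 2))) := by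
    rw [neg_sq] at h2
    linarith
  rw [← le_div_iff₀ (Real.exp_pos _)] at h3
  refine h3.trans (le_of_eq ?_)
  rw [mul_div_assoc, mul_div_assoc, ← Real.exp_sub]
  congr 3
  rw [hl]
  field_simp
  ring

/-! ### Sauer-Shelah bounds on traces -/

theorem sum_Iic_choose_le (N V : ℕ) : ∑ k ∈ Finset.Iic V, N.choose k ≤ (N + 1) ^ V := by
  rw [add_pow]
  have : Finset.Iic V = Finset.range (V + 1) := by ext; simp
  rw [this]
  refine Finset.sum_le_sum fun k hk => ?_
  have hk' : k ≤ V := Nat.lt_succ_iff.1 (Finset.mem_range.1 hk)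
  calc N.choose k ≤ N ^ k := Nat.choose_le_pow ..
    _ ≤ N ^ k * 1 ^ (V - k) * V.choose k := by
      rw [one_pow, mul_one]
      exact Nat.le_mul_of_pos_right _ (Nat.choose_pos hk')

open Classical in
/-- The Sauer-Shelah bound on the number of traces of a class of sets on finitely many points. -/
theorem card_traces_le {α : Type u} {A : Set (Set α)} {V : ℕ} (hV : classVCDim A ≤ V)
    {ι : Type*} [Fintype ι] (x : ι → α) (𝒜 : Finset (Finset ι))
    (h𝒜 : ∀ s ∈ 𝒜, ∃ a ∈ A, s = Finset.univ.filter fun i => x i ∈ a) :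
    𝒜.card ≤ (Fintype.card ι + 1) ^ V := by
  have hdim : 𝒜.vcDim ≤ V := by
    refine Finset.sup_le fun s hs => ?_
    have hs := Finset.mem_shatterer.1 hs
    -- Indices with equal points lie in the same traces, so the trace {i} could not be cut out.
    -- Hence a shattered index set maps injectively to a shattered point set.
    have hinj : Set.InjOn x (s : Set ι) := by
      intro i hi j hj hij
      obtain ⟨u, hu, hui⟩ := hs (Finset.singleton_subset_iff.2 hi)
      obtain ⟨a, -, rfl⟩ := h𝒜 u hu
      have h1 : i ∈ s ∩ Finset.univ.filter fun i => x i ∈ a := by rw [hui]; simp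
      have h2 : j ∈ s ∩ Finset.univ.filter fun i => x i ∈ a := by
        simp only [Finset.mem_inter, Finset.mem_filter, Finset.mem_univ, true_and] at h1 ⊢
        exact ⟨hj, hij ▸ h1.2⟩
      rw [hui] at h2
      exact (Finset.mem_singleton.1 h2).symm
    have hsh : ClassShatters A (s.image x) := by
      intro C₀ hC₀
      obtain ⟨u, hu, hui⟩ := hs (Finset.filter_subset (fun i => x i ∈ C₀) s)
      obtain ⟨a, ha, rfl⟩ := h𝒜 u hu
      refine ⟨a, ha, ?_⟩
      ext y
      constructor
      · rintro ⟨hya, hy⟩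
        obtain ⟨i, hi, rfl⟩ := Finset.mem_image.1 (Finset.mem_coe.1 hy)
        have : i ∈ s.filter fun i => x i ∈ C₀ := by
          rw [← hui]; simp [hi, hya]
        exact (Finset.mem_filter.1 this).2
      · intro hy
        obtain ⟨i, hi, rfl⟩ := Finset.mem_image.1 (Finset.mem_coe.1 (hC₀ hy))
        have : i ∈ s ∩ Finset.univ.filter fun i => x i ∈ a := by
          rw [hui]; simp [hi, hy]
        simp only [Finset.mem_inter, Finset.mem_filter, Finset.mem_univ, true_and] at this
        exact ⟨this.2, hC₀ hy⟩
    have h1 : ((s.image x).card : ℕ∞) ≤ classVCDim A :=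
      le_iSup₂_of_le (f := fun (C : Finset α) (_ : ClassShatters A C) => (C.card : ℕ∞))
        (s.image x) hsh le_rfl
    rw [Finset.card_image_of_injOn hinj] at h1
    exact_mod_cast h1.trans hV
  calc 𝒜.card ≤ 𝒜.shatterer.card := Finset.card_le_card_shatterer 𝒜
    _ ≤ ∑ k ∈ Finset.Iic 𝒜.vcDim, (Fintype.card ι).choose k := Finset.card_shatterer_le_sum_vcDim
    _ ≤ ∑ k ∈ Finset.Iic V, (Fintype.card ι).choose k :=
        Finset.sum_le_sum_of_subset (Finset.Iic_subset_Iic.2 hdim)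
    _ ≤ _ := sum_Iic_choose_le _ _

open Classical in
/-- Finitely many members of a class of functions represent all traces of the subgraphs on
finitely many points. -/
theorem exists_trace_representatives {𝕏 : Type u} {Θ : Type v} {f : Θ → 𝕏 → ℝ} {V : ℕ}
    (hV : pseudoDim (Set.range f) ≤ V) {ι : Type*} [Fintype ι] (x : ι → 𝕏 × ℝ) :
    ∃ T : Finset Θ, T.card ≤ (Fintype.card ι + 1) ^ V ∧
      ∀ θ, ∃ θ' ∈ T, ∀ i, (x i).2 ≤ f θ (x i).1 ↔ (x i).2 ≤ f θ' (x i).1 := by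
  set tr : Θ → Finset ι := fun θ => Finset.univ.filter fun i => x i ∈ subgraph (f θ) with htr
  set 𝒜 : Finset (Finset ι) := Finset.univ.filter fun s => ∃ θ, tr θ = s with h𝒜
  have hcard : 𝒜.card ≤ (Fintype.card ι + 1) ^ V := by
    refine card_traces_le hV x 𝒜 fun s hs => ?_
    obtain ⟨θ, rfl⟩ := (Finset.mem_filter.1 hs).2
    exact ⟨_, ⟨_, ⟨θ, rfl⟩, rfl⟩, rfl⟩
  have hch : ∀ s : 𝒜, ∃ θ, tr θ = s := fun s => (Finset.mem_filter.1 s.2).2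
  choose g hg using hch
  refine ⟨Finset.univ.image g, ?_, fun θ => ?_⟩
  · refine Finset.card_image_le.trans ?_
    simpa using hcard
  · have hmem : tr θ ∈ 𝒜 := by simp [h𝒜]
    refine ⟨g ⟨tr θ, hmem⟩, Finset.mem_image_of_mem _ (Finset.mem_univ _), fun i => ?_⟩
    have htr' : ∀ θ, i ∈ tr θ ↔ (x i).2 ≤ f θ (x i).1 := fun θ =>
      ⟨fun h => (Finset.mem_filter.1 h).2, fun h => Finset.mem_filter.2 ⟨Finset.mem_univ _, h⟩⟩
    rw [← htr', ← htr', hg]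

/-! ### Symmetrization and the abstract uniform law -/

/-- Chebyshev's weak law of large numbers for bounded functions. -/
theorem pi_average_deviation_le_half {Z : Type*} [MeasurableSpace Z] (ρ : Measure Z)
    [IsProbabilityMeasure ρ] {g : Z → ℝ} (hg : Measurable g) {M : ℝ} (hM : ∀ z, |g z| ≤ M)
    {t : ℝ} (ht : 0 < t) {n : ℕ} (hn : 0 < n) (hnM : 8 * M ^ 2 ≤ n * t ^ 2) :
    (Measure.pi fun _ : Fin n => ρ)
      {z | t / 2 ≤ |(1 / (n : ℝ)) * ∑ i, g (z i) - ∫ x, g x ∂ρ|} ≤ ENNReal.ofReal (1 / 2) := by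
  have hn' : (0 : ℝ) < n := by exact_mod_cast hn
  have hmem : MemLp g 2 ρ := MemLp.of_bound hg.aestronglyMeasurable M (ae_of_all _ hM)
  have hmem' : ∀ i : Fin n, MemLp (fun z : Fin n → Z => g (z i)) 2 (Measure.pi fun _ => ρ) :=
    fun i => hmem.comp_measurePreserving (measurePreserving_eval (fun _ : Fin n => ρ) i)
  have hS : MemLp (fun z : Fin n → Z => ∑ i, g (z i)) 2 (Measure.pi fun _ => ρ) :=
    memLp_finsetSum _ fun i _ => hmem' i
  have hint : ∫ z : Fin n → Z, ∑ i, g (z i) ∂(Measure.pi fun _ => ρ) = n * ∫ x, g x ∂ρ := by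
    rw [integral_finsetSum _ fun i _ => (hmem' i).integrable (by norm_num)]
    have : ∀ i : Fin n, ∫ z : Fin n → Z, g (z i) ∂(Measure.pi fun _ => ρ) = ∫ x, g x ∂ρ := by
      intro i
      have := integral_map (μ := Measure.pi fun _ : Fin n => ρ) (φ := fun z => z i) (f := g)
        (measurable_pi_apply i).aemeasurable hg.aestronglyMeasurable
      rw [← this, (measurePreserving_eval (fun _ : Fin n => ρ) i).map_eq]
    simp [this]
  have hvar : variance (fun z : Fin n → Z => ∑ i, g (z i)) (Measure.pi fun _ => ρ) ≤
      n * M ^ 2 := by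
    have h := variance_sum_pi (μ := fun _ : Fin n => ρ) (X := fun _ => g) fun _ => hmem
    have h2 : (∑ i : Fin n, fun ω : Fin n → Z => g (ω i)) = fun z => ∑ i, g (z i) := by
      ext; simp
    rw [h2] at h
    rw [h]
    have := variance_le_sq_of_bounded (μ := ρ) (X := g) (a := -M) (b := M)
      (ae_of_all _ fun z => abs_le.1 (hM z)) hg.aemeasurable
    simp only [Finset.sum_const, Finset.card_univ, Fintype.card_fin, nsmul_eq_mul]
    refine mul_le_mul_of_nonneg_left (this.trans (le_of_eq ?_)) hn'.le
    ring
  have hc : 0 < n * (t / 2) := by positivity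
  have h := meas_ge_le_variance_div_sq hS hc
  rw [hint] at h
  refine le_trans (measure_mono ?_) (h.trans (ENNReal.ofReal_le_ofReal ?_))
  · intro z hz
    have hz : t / 2 ≤ |(1 / (n : ℝ)) * ∑ i, g (z i) - ∫ x, g x ∂ρ| := hz
    change n * (t / 2) ≤ |∑ i, g (z i) - n * ∫ x, g x ∂ρ|
    have : ∑ i, g (z i) - n * ∫ x, g x ∂ρ =
        n * ((1 / (n : ℝ)) * ∑ i, g (z i) - ∫ x, g x ∂ρ) := by field_simp
    rw [this, abs_mul, abs_of_pos hn']
    gcongr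
  -- The Chebyshev quotient is at most 4M²/(n t²), which `hnM` bounds by 1/2.
  · rw [div_le_iff₀ (by positivity)]
    nlinarith

/-- The event that some member of the class has distant averages on the two halves of a double
sample. -/
def doubleSampleEvent {P Z : Type*} (G : P → Z → ℝ) (n : ℕ) (s : ℝ) :
    Set (Fin n ⊕ Fin n → Z) :=
  {z | ∃ p, n * s < |∑ i, (G p (z (Sum.inl i)) - G p (z (Sum.inr i)))|}

/-- Symmetrization by a ghost sample, for outer measure. -/
theorem pi_deviation_le_two_mul_doubleSample {P Z : Type*} [MeasurableSpace Z] (ρ : Measure Z)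
    [IsProbabilityMeasure ρ] {G : P → Z → ℝ} (hG : ∀ p, Measurable (G p)) {M : ℝ}
    (hM : ∀ p z, |G p z| ≤ M) {t : ℝ} (ht : 0 < t) {n : ℕ} (hn : 0 < n)
    (hnM : 8 * M ^ 2 ≤ n * t ^ 2) :
    (Measure.pi fun _ : Fin n => ρ)
        {z | ∃ p, t < |(1 / (n : ℝ)) * ∑ i, G p (z i) - ∫ x, G p x ∂ρ|} ≤
      2 * (Measure.pi fun _ : Fin n ⊕ Fin n => ρ) (doubleSampleEvent G n (t / 2)) := by
  have hn' : (0 : ℝ) < n := by exact_mod_cast hn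
  set ν := Measure.pi fun _ : Fin n => ρ with hν
  set e := (MeasurableEquiv.sumPiEquivProdPi fun _ : Fin n ⊕ Fin n => Z).symm with he
  have hmp : MeasurePreserving e (ν.prod ν) (Measure.pi fun _ : Fin n ⊕ Fin n => ρ) :=
    measurePreserving_sumPiEquivProdPi_symm fun _ : Fin n ⊕ Fin n => ρ
  set B := e ⁻¹' (doubleSampleEvent G n (t / 2)) with hB
  have hBm : (ν.prod ν) B =
      (Measure.pi fun _ : Fin n ⊕ Fin n => ρ) (doubleSampleEvent G n (t / 2)) :=
    hmp.measure_preimage_equiv _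
  -- No measurability of the event is assumed here, so Fubini is applied to a measurable hull.
  rw [← hBm, ← measure_toMeasurable B]
  set B' := toMeasurable (ν.prod ν) B with hB'
  have hB'm : MeasurableSet B' := measurableSet_toMeasurable _ _
  rw [Measure.prod_apply hB'm]
  set A := {z : Fin n → Z | ∃ p, t < |(1 / (n : ℝ)) * ∑ i, G p (z i) - ∫ x, G p x ∂ρ|} with hA
  -- For a witness p on the first half, the ghost half is within t/2 of the mean of p with
  -- probability at least 1/2, and then the halves differ by more than t/2. Markov's inequality
  -- finishes.
  have hsub : A ⊆ {z | ENNReal.ofReal (1 / 2) ≤ ν (Prod.mk z ⁻¹' B')} := by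
    rintro z ⟨p, hp⟩
    have h1 := pi_average_deviation_le_half ρ (hG p) (hM p) ht hn hnM
    set E := {z : Fin n → Z | t / 2 ≤ |(1 / (n : ℝ)) * ∑ i, G p (z i) - ∫ x, G p x ∂ρ|} with hE
    have hEm : MeasurableSet E := by
      refine measurableSet_le measurable_const ?_
      refine Measurable.abs (Measurable.sub_const (Measurable.const_mul ?_ _) _)
      exact Finset.measurable_sum _ fun i _ => (hG p).comp (measurable_pi_apply i)
    have h2 : Eᶜ ⊆ Prod.mk z ⁻¹' B' := by
      intro z' hz'
      refine subset_toMeasurable _ _ ?_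
      refine ⟨p, ?_⟩
      have hz'' : |(1 / (n : ℝ)) * ∑ i, G p (z' i) - ∫ x, G p x ∂ρ| < t / 2 := not_le.1 hz'
      change n * (t / 2) < |∑ i, (G p (z i) - G p (z' i))|
      rw [Finset.sum_sub_distrib]
      have h3 : ∑ i, G p (z i) - ∑ i, G p (z' i) =
          n * (((1 / (n : ℝ)) * ∑ i, G p (z i) - ∫ x, G p x ∂ρ) -
            ((1 / (n : ℝ)) * ∑ i, G p (z' i) - ∫ x, G p x ∂ρ)) := by
        field_simp
        ring
      rw [h3, abs_mul, abs_of_pos hn']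
      have := abs_sub_abs_le_abs_sub ((1 / (n : ℝ)) * ∑ i, G p (z i) - ∫ x, G p x ∂ρ)
        ((1 / (n : ℝ)) * ∑ i, G p (z' i) - ∫ x, G p x ∂ρ)
      gcongr
      linarith
    refine le_trans ?_ (measure_mono h2)
    rw [prob_compl_eq_one_sub hEm]
    calc ENNReal.ofReal (1 / 2) = 1 - ENNReal.ofReal (1 / 2) := by
          rw [← ENNReal.ofReal_one, ← ENNReal.ofReal_sub _ (by norm_num)]; norm_num
      _ ≤ 1 - ν E := tsub_le_tsub_left h1 _
  calc ν A ≤ ν {z | ENNReal.ofReal (1 / 2) ≤ ν (Prod.mk z ⁻¹' B')} := measure_mono hsub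
    _ = 2 * (ENNReal.ofReal (1 / 2) * ν {z | ENNReal.ofReal (1 / 2) ≤ ν (Prod.mk z ⁻¹' B')}) := by
        rw [← mul_assoc]
        have : (2 : ℝ≥0∞) * ENNReal.ofReal (1 / 2) = 1 := by
          rw [← ENNReal.ofReal_ofNat 2, ← ENNReal.ofReal_mul (by norm_num)]; norm_num
        rw [this, one_mul]
    _ ≤ _ := by
        gcongr
        exact mul_meas_ge_le_lintegral (measurable_measure_prodMk_left hB'm) _

/-- The permutation of a double sample that swaps the pairs not marked by `e`. -/
def swapPairs {n : ℕ} (e : Fin n → Bool) : Equiv.Perm (Fin n ⊕ Fin n) where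
  toFun := Sum.elim (fun i => if e i then Sum.inl i else Sum.inr i)
    (fun i => if e i then Sum.inr i else Sum.inl i)
  invFun := Sum.elim (fun i => if e i then Sum.inl i else Sum.inr i)
    (fun i => if e i then Sum.inr i else Sum.inl i)
  left_inv x := by rcases x with i | i <;> by_cases h : e i <;> simp [h]
  right_inv x := by rcases x with i | i <;> by_cases h : e i <;> simp [h]

/-- Exchangeability of i.i.d. coordinates, needed for swaps and for reindexing a double sample by
`Fin (n + n)`. -/
theorem measurePreserving_comp_equiv {ι κ Z : Type*} [Fintype ι] [Fintype κ] [MeasurableSpace Z]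
    (ρ : Measure Z) [SigmaFinite ρ] (e : κ ≃ ι) :
    MeasurePreserving (fun (z : ι → Z) k => z (e k)) (Measure.pi fun _ : ι => ρ)
      (Measure.pi fun _ : κ => ρ) :=
  measurePreserving_arrowCongr' (fun _ : ι => ρ) (fun _ : κ => ρ) e.symm
    (MeasurableEquiv.refl Z) fun _ => MeasurePreserving.id ρ

open Classical in
/-- A union bound over an empirical cover, for the signed sums of a class on a double sample. -/
theorem card_swapPairs_mem_le {P Z : Type*} {G : P → Z → ℝ} {M : ℝ} (hM0 : 0 < M)
    (hM : ∀ p z, |G p z| ≤ M) {t : ℝ} (ht : 0 < t) {n : ℕ} {N : ℝ} (z : Fin n ⊕ Fin n → Z)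
    {T : Finset P} (hT : (T.card : ℝ) ≤ N)
    (hcov : ∀ p, ∃ p' ∈ T, ∀ i, |G p (z i) - G p' (z i)| ≤ t / 8) :
    ((Finset.univ.filter fun e : Fin n → Bool =>
        (fun i => z (swapPairs e i)) ∈ doubleSampleEvent G n (t / 2)).card : ℝ) ≤
      2 ^ n * (N * (2 * Real.exp (-n * t ^ 2 / (128 * M ^ 2)))) := by
  set a : P → Fin n → ℝ := fun p i => G p (z (Sum.inl i)) - G p (z (Sum.inr i)) with ha
  have hsum : ∀ (e : Fin n → Bool) p,
      ∑ i, (G p (z (swapPairs e (Sum.inl i))) - G p (z (swapPairs e (Sum.inr i)))) =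
        ∑ i, (if e i then a p i else -a p i) := by
    intro e p
    refine Finset.sum_congr rfl fun i _ => ?_
    by_cases h : e i <;> simp [swapPairs, h, ha]
  have hsub : (Finset.univ.filter fun e : Fin n → Bool =>
        (fun i => z (swapPairs e i)) ∈ doubleSampleEvent G n (t / 2)) ⊆
      T.biUnion fun p => Finset.univ.filter fun e : Fin n → Bool =>
        n * (t / 4) < |∑ i, (if e i then a p i else -a p i)| := by
    intro e he
    obtain ⟨p, hp⟩ := (Finset.mem_filter.1 he).2
    rw [hsum] at hp
    obtain ⟨p', hp'T, hp'⟩ := hcov p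
    refine Finset.mem_biUnion.2 ⟨p', hp'T, Finset.mem_filter.2 ⟨Finset.mem_univ _, ?_⟩⟩
    -- Passing to the cover costs t/8 in each half, t/4 per pair; the remaining deviation is t/2 -
    -- t/4 = t/4.
    have hd : |∑ i, (if e i then a p i else -a p i) - ∑ i, (if e i then a p' i else -a p' i)| ≤
        n * (t / 4) := by
      rw [← Finset.sum_sub_distrib]
      refine (Finset.abs_sum_le_sum_abs _ _).trans ?_
      refine (Finset.sum_le_card_nsmul _ _ (t / 4) fun i _ => ?_).trans (by simp)
      have h1 := abs_le.1 (hp' (Sum.inl i))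
      have h2 := abs_le.1 (hp' (Sum.inr i))
      rw [abs_le]
      split_ifs <;> simp only [ha] <;> constructor <;> linarith
    have := abs_sub_abs_le_abs_sub (∑ i, (if e i then a p i else -a p i))
      (∑ i, (if e i then a p' i else -a p' i))
    linarith
  have hb : ∀ p i, |a p i| ≤ 2 * M := fun p i => by
    have h1 := abs_le.1 (hM p (z (Sum.inl i)))
    have h2 := abs_le.1 (hM p (z (Sum.inr i)))
    rw [abs_le]
    constructor <;> simp only [ha] <;> linarith
  calc _ ≤ ((T.biUnion fun p => Finset.univ.filter fun e : Fin n → Bool =>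
        n * (t / 4) < |∑ i, (if e i then a p i else -a p i)|).card : ℝ) := by
        exact_mod_cast Finset.card_le_card hsub
    _ ≤ ∑ p ∈ T, ((Finset.univ.filter fun e : Fin n → Bool =>
        n * (t / 4) < |∑ i, (if e i then a p i else -a p i)|).card : ℝ) := by
        exact_mod_cast Finset.card_biUnion_le
    _ ≤ ∑ _p ∈ T, 2 ^ n * (2 * Real.exp (-n * (t / 4) ^ 2 / (2 * (2 * M) ^ 2))) :=
        Finset.sum_le_sum fun p _ =>
          card_signed_sum_gt_le (by positivity) (hb p) (by positivity)
    _ = 2 ^ n * (T.card * (2 * Real.exp (-n * t ^ 2 / (128 * M ^ 2)))) := by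
        rw [Finset.sum_const, nsmul_eq_mul]
        have : -n * (t / 4) ^ 2 / (2 * (2 * M) ^ 2) = -n * t ^ 2 / (128 * M ^ 2) := by
          field_simp; ring
        rw [this]
        ring
    _ ≤ _ := by gcongr

open Classical in
/-- Symmetrization by random swaps of a double sample. -/
theorem pi_doubleSample_le {P Z : Type*} [MeasurableSpace Z] (ρ : Measure Z)
    [IsProbabilityMeasure ρ] {G : P → Z → ℝ} {M : ℝ} (hM0 : 0 < M)
    (hM : ∀ p z, |G p z| ≤ M) {t : ℝ} (ht : 0 < t) {n : ℕ} {N : ℝ}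
    (hnull : NullMeasurableSet (doubleSampleEvent G n (t / 2))
      (Measure.pi fun _ : Fin n ⊕ Fin n => ρ))
    (hcov : ∀ z : Fin n ⊕ Fin n → Z, ∃ T : Finset P, (T.card : ℝ) ≤ N ∧
      ∀ p, ∃ p' ∈ T, ∀ i, |G p (z i) - G p' (z i)| ≤ t / 8) :
    (Measure.pi fun _ : Fin n ⊕ Fin n => ρ) (doubleSampleEvent G n (t / 2)) ≤
      ENNReal.ofReal (N * (2 * Real.exp (-n * t ^ 2 / (128 * M ^ 2)))) := by
  set B := doubleSampleEvent G n (t / 2) with hB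
  set ν := Measure.pi fun _ : Fin n ⊕ Fin n => ρ with hν
  set c := N * (2 * Real.exp (-n * t ^ 2 / (128 * M ^ 2))) with hc
  have hmp := fun e : Fin n → Bool => measurePreserving_comp_equiv ρ (swapPairs e)
  have hmeas : ∀ e : Fin n → Bool,
      ν ((fun (z : Fin n ⊕ Fin n → Z) i => z (swapPairs e i)) ⁻¹' B) = ν B :=
    fun e => (hmp e).measure_preimage hnull
  have hnull' : ∀ e : Fin n → Bool,
      NullMeasurableSet ((fun (z : Fin n ⊕ Fin n → Z) i => z (swapPairs e i)) ⁻¹' B) ν :=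
    fun e => hnull.preimage (hmp e).quasiMeasurePreserving
  -- For each fixed double sample only few swap patterns are bad. Integrating this count gives 2^n ν
  -- B, as swaps preserve ν.
  have hpt : ∀ z : Fin n ⊕ Fin n → Z, ∑ e : Fin n → Bool,
      ((fun (z : Fin n ⊕ Fin n → Z) i => z (swapPairs e i)) ⁻¹' B).indicator
        (fun _ => (1 : ℝ≥0∞)) z ≤ ENNReal.ofReal (2 ^ n * c) := by
    intro z
    obtain ⟨T, hT, hT'⟩ := hcov z
    have h := card_swapPairs_mem_le hM0 hM ht z hT hT'
    simp only [Set.indicator_apply, Set.mem_preimage]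
    rw [Finset.sum_boole, ← ENNReal.ofReal_natCast]
    exact ENNReal.ofReal_le_ofReal h
  have hsum : (2 ^ n : ℝ≥0∞) * ν B ≤ ENNReal.ofReal (2 ^ n * c) := by
    calc (2 ^ n : ℝ≥0∞) * ν B = ∑ e : Fin n → Bool,
          ν ((fun (z : Fin n ⊕ Fin n → Z) i => z (swapPairs e i)) ⁻¹' B) := by
          simp [hmeas]
      _ = ∑ e : Fin n → Bool, ∫⁻ z,
          ((fun (z : Fin n ⊕ Fin n → Z) i => z (swapPairs e i)) ⁻¹' B).indicator
            (fun _ => (1 : ℝ≥0∞)) z ∂ν := by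
          refine Finset.sum_congr rfl fun e _ => ?_
          rw [lintegral_indicator_const₀ (hnull' e), one_mul]
      _ = ∫⁻ z, ∑ e : Fin n → Bool,
          ((fun (z : Fin n ⊕ Fin n → Z) i => z (swapPairs e i)) ⁻¹' B).indicator
            (fun _ => (1 : ℝ≥0∞)) z ∂ν :=
          (lintegral_finsetSum' _ fun e _ =>
            (aemeasurable_const.indicator₀ (hnull' e))).symm
      _ ≤ ∫⁻ _z, ENNReal.ofReal (2 ^ n * c) ∂ν := lintegral_mono hpt
      _ = _ := by simp
  rw [ENNReal.ofReal_mul (by positivity), ENNReal.ofReal_pow (by norm_num),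
    ENNReal.ofReal_ofNat] at hsum
  exact (ENNReal.mul_le_mul_iff_right (by simp) (by simp)).1 hsum

/-- A uniform law of large numbers with exponential tails, for bounded classes with finite
empirical covers whose suprema are measurable up to null sets. -/
theorem pi_uniform_deviation_le {P Z : Type*} [MeasurableSpace Z] (ρ : Measure Z)
    [IsProbabilityMeasure ρ] {G : P → Z → ℝ} (hG : ∀ p, Measurable (G p)) {M : ℝ} (hM0 : 0 < M)
    (hM : ∀ p z, |G p z| ≤ M) {t : ℝ} (ht : 0 < t) {n : ℕ} (hn : 0 < n)
    (hnM : 8 * M ^ 2 ≤ n * t ^ 2) {N : ℝ}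
    (hnull : NullMeasurableSet (doubleSampleEvent G n (t / 2))
      (Measure.pi fun _ : Fin n ⊕ Fin n => ρ))
    (hcov : ∀ z : Fin n ⊕ Fin n → Z, ∃ T : Finset P, (T.card : ℝ) ≤ N ∧
      ∀ p, ∃ p' ∈ T, ∀ i, |G p (z i) - G p' (z i)| ≤ t / 8) :
    (Measure.pi fun _ : Fin n => ρ)
        {z | ∃ p, t < |(1 / (n : ℝ)) * ∑ i, G p (z i) - ∫ x, G p x ∂ρ|} ≤
      ENNReal.ofReal (4 * N * Real.exp (-n * t ^ 2 / (128 * M ^ 2))) := by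
  refine (pi_deviation_le_two_mul_doubleSample ρ hG hM ht hn hnM).trans ?_
  refine (mul_le_mul_right (pi_doubleSample_le ρ hM0 hM ht hnull hcov) 2).trans (le_of_eq ?_)
  rw [← ENNReal.ofReal_ofNat 2, ← ENNReal.ofReal_mul (by norm_num)]
  congr 1
  ring

/-! ### Stable losses: covers, measurability, uniform law -/

/-- Losses `h (a, b, x, v)` that are bounded, measurable, and vary little as long as the values
`a`, `b` vary little and `a` stays on the same side of `-v`. -/
structure IsStableLoss {𝕏 : Type u} [MeasurableSpace 𝕏] (h : ℝ × ℝ × 𝕏 × ℝ → ℝ) : Prop where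
  measurable : Measurable h
  bounded : ∀ w, |h w| ≤ 4
  stable : ∀ (a a' b b' η : ℝ) (x : 𝕏) (v : ℝ), a ∈ Set.Icc (-1 : ℝ) 1 → a' ∈ Set.Icc (-1 : ℝ) 1 →
    b ∈ Set.Icc (-1 : ℝ) 1 → b' ∈ Set.Icc (-1 : ℝ) 1 → |a - a'| ≤ η → |b - b'| ≤ η →
    (-v ≤ a ↔ -v ≤ a') → |h (a, b, x, v) - h (a', b', x, v)| ≤ 8 * η

/-- The loss of a pair of members of the class on a marked input. -/
def pairLoss {𝕏 : Type u} {Θ : Type v} (h : ℝ × ℝ × 𝕏 × ℝ → ℝ) (f : Θ → 𝕏 → ℝ) (p : Θ × Θ)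
    (z : 𝕏 × ℝ) : ℝ :=
  h (f p.1 z.1, f p.2 z.1, z.1, z.2)

/-- The largest grid point below the larger value also lies below the smaller one, so both share a
cell of width η. -/
theorem abs_sub_le_of_grid {η a a' : ℝ} (hη : 0 < η) (ha : a ∈ Set.Icc (-1 : ℝ) 1)
    (ha' : a' ∈ Set.Icc (-1 : ℝ) 1)
    (h : ∀ k : Fin (⌊2 / η⌋₊ + 1), -1 + (k : ℝ) * η ≤ a ↔ -1 + (k : ℝ) * η ≤ a') :
    |a - a'| ≤ η := by
  wlog haa : a ≤ a' generalizing a a'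
  · rw [abs_sub_comm]
    exact this ha' ha (fun k => (h k).symm) (le_of_not_ge haa)
  rw [abs_sub_comm, abs_of_nonneg (by linarith)]
  have h0 : 0 ≤ (a' + 1) / η := div_nonneg (by linarith [ha'.1]) hη.le
  have hk : ⌊(a' + 1) / η⌋₊ < ⌊2 / η⌋₊ + 1 := by
    refine Nat.lt_succ_of_le (Nat.floor_le_floor ?_)
    have := ha'.2
    gcongr
    linarith
  have h1 : (⌊(a' + 1) / η⌋₊ : ℝ) * η ≤ a' + 1 := by
    rw [← le_div_iff₀ hη]; exact Nat.floor_le h0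
  have h2 : a' + 1 < ((⌊(a' + 1) / η⌋₊ : ℝ) + 1) * η := by
    rw [← div_lt_iff₀ hη]; exact Nat.lt_floor_add_one _
  have h3 := (h ⟨_, hk⟩).2 (by simp only; linarith)
  simp only at h3
  linarith

/-- A class of finite pseudo-dimension has empirical covers of polynomial size for stable
losses of pairs. -/
theorem exists_pairLoss_cover {𝕏 : Type u} [MeasurableSpace 𝕏] {Θ : Type v} {f : Θ → 𝕏 → ℝ}
    (hf : ∀ θ x, f θ x ∈ Set.Icc (-1 : ℝ) 1) {V : ℕ} (hV : pseudoDim (Set.range f) ≤ V)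
    {h : ℝ × ℝ × 𝕏 × ℝ → ℝ} (hh : IsStableLoss h) {t : ℝ} (ht : 0 < t) {ι : Type*} [Fintype ι]
    (z : ι → 𝕏 × ℝ) :
    ∃ T : Finset (Θ × Θ),
      (T.card : ℝ) ≤ ((Fintype.card ι * (⌊2 / (t / 64)⌋₊ + 2) + 1 : ℝ) ^ V) ^ 2 ∧
      ∀ p, ∃ p' ∈ T, ∀ i, |pairLoss h f p (z i) - pairLoss h f p' (z i)| ≤ t / 8 := by
  -- The stability constant 8 turns η into the required t/8.
  set η := t / 64 with hη
  have hη0 : 0 < η := by positivity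
  set K := ⌊2 / η⌋₊ + 1 with hK
  -- At each input the levels `some k` locate the function value up to η, and the level `none`, at
  -- -v, fixes the side of the jump.
  obtain ⟨T, hT, hT'⟩ := exists_trace_representatives hV
    (ι := ι × Option (Fin K)) fun j =>
      ((z j.1).1, j.2.elim (-(z j.1).2) fun k => -1 + ((k : ℕ) : ℝ) * η)
  refine ⟨T ×ˢ T, ?_, fun p => ?_⟩
  · rw [Finset.card_product, ← sq, Nat.cast_pow]
    refine pow_le_pow_left₀ (by positivity) ?_ 2
    refine (Nat.cast_le.2 hT).trans (le_of_eq ?_)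
    simp [hK]
    ring
  · obtain ⟨p₁, hp₁, h1⟩ := hT' p.1
    obtain ⟨p₂, hp₂, h2⟩ := hT' p.2
    refine ⟨(p₁, p₂), Finset.mk_mem_product hp₁ hp₂, fun i => ?_⟩
    have ha := abs_sub_le_of_grid hη0 (hf p.1 (z i).1) (hf p₁ (z i).1)
      fun k => h1 (i, some k)
    have hb := abs_sub_le_of_grid hη0 (hf p.2 (z i).1) (hf p₂ (z i).1)
      fun k => h2 (i, some k)
    refine (hh.stable _ _ _ _ η _ _ (hf _ _) (hf _ _) (hf _ _) (hf _ _) ha hb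
      (h1 (i, none))).trans (le_of_eq ?_)
    rw [hη]; ring

/-- The event is a superlevel set of a supremum over a sample of size 2n, with index-dependent
weights +1 on one half and -1 on the other. -/
theorem MeasurableSuprema.nullMeasurableSet_doubleSampleEvent {𝕏 : Type u} [MeasurableSpace 𝕏]
    {Θ : Type v} {μ : Measure 𝕏} {f : Θ → 𝕏 → ℝ} (hsup : MeasurableSuprema μ f)
    {ρ : Measure (𝕏 × ℝ)} [IsProbabilityMeasure ρ] (hρ : ρ.fst = μ)
    {h : ℝ × ℝ × 𝕏 × ℝ → ℝ} (hh : IsStableLoss h) {n : ℕ} {s : ℝ} (hs : 0 ≤ s) :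
    NullMeasurableSet (doubleSampleEvent (pairLoss h f) n s)
      (Measure.pi fun _ : Fin n ⊕ Fin n => ρ) := by
  have h1 := hsup ρ inferInstance hρ (n + n)
    (fun i w => (Sum.elim (fun _ => (1 : ℝ)) (fun _ => -1) (finSumFinEquiv.symm i)) * h w)
    (fun i => hh.measurable.const_mul _) ⟨4, fun i w => by
      rcases finSumFinEquiv.symm i with j | j <;> simpa using hh.bounded w⟩
  have h2 := h1.comp_quasiMeasurePreserving
    (measurePreserving_comp_equiv ρ (finSumFinEquiv (m := n) (n := n)).symm).quasiMeasurePreserving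
  have hsum : ∀ (z : Fin n ⊕ Fin n → 𝕏 × ℝ) (p : Θ × Θ),
      ∑ i, (Sum.elim (fun _ => (1 : ℝ)) (fun _ => -1) (finSumFinEquiv.symm i)) *
        h (f p.1 (z (finSumFinEquiv.symm i)).1, f p.2 (z (finSumFinEquiv.symm i)).1,
          (z (finSumFinEquiv.symm i)).1, (z (finSumFinEquiv.symm i)).2) =
      ∑ i, (pairLoss h f p (z (Sum.inl i)) - pairLoss h f p (z (Sum.inr i))) := by
    intro z p
    rw [Equiv.sum_comp finSumFinEquiv.symm fun j =>
      (Sum.elim (fun _ => (1 : ℝ)) (fun _ => -1) j) * h (f p.1 (z j).1, f p.2 (z j).1,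
        (z j).1, (z j).2), Fintype.sum_sum_type, Finset.sum_sub_distrib]
    simp [pairLoss, sub_eq_add_neg]
  have h3 : doubleSampleEvent (pairLoss h f) n s = {z | n * s < ⨆ p : Θ × Θ,
      |∑ i, (pairLoss h f p (z (Sum.inl i)) - pairLoss h f p (z (Sum.inr i)))|} := by
    ext z
    have hbdd : BddAbove (Set.range fun p : Θ × Θ =>
        |∑ i, (pairLoss h f p (z (Sum.inl i)) - pairLoss h f p (z (Sum.inr i)))|) := by
      refine ⟨n * 8, ?_⟩
      rintro _ ⟨p, rfl⟩
      refine (Finset.abs_sum_le_sum_abs _ _).trans ?_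
      refine (Finset.sum_le_card_nsmul _ _ 8 fun i _ => ?_).trans (by simp)
      have h1 : |pairLoss h f p (z (Sum.inl i))| ≤ 4 := hh.bounded _
      have h2 : |pairLoss h f p (z (Sum.inr i))| ≤ 4 := hh.bounded _
      exact (abs_sub _ _).trans (by linarith)
    simp only [doubleSampleEvent, Set.mem_ofPred_eq]
    -- An empty real supremum is 0, so `0 ≤ s` makes both sides false.
    rcases isEmpty_or_nonempty (Θ × Θ) with he | he
    · simp only [IsEmpty.exists_iff, Real.iSup_of_isEmpty, false_iff, not_lt]
      positivity
    · exact (lt_ciSup_iff hbdd).symm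
  rw [h3]
  refine nullMeasurableSet_lt aemeasurable_const (h2.congr (ae_of_all _ fun z => ?_))
  simp only [Function.comp]
  exact iSup_congr fun p => congrArg _ (hsum z p)

/-- Half of the exponential rate pays for the polynomial size of the cover. -/
theorem eventually_poly_mul_exp_le {a b c : ℝ} (ha : 0 < a) (hb : 0 ≤ b) (hc : 0 < c) (k : ℕ) :
    ∀ᶠ n : ℕ in atTop,
      (b * n + 1) ^ k * Real.exp (-(n : ℝ) * (2 * a)) ≤ c * Real.exp (-(n : ℝ) * a) := by
  have h1 := (tendsto_rpow_mul_exp_neg_mul_atTop_nhds_zero (k : ℝ) a ha).comp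
    (tendsto_natCast_atTop_atTop (R := ℝ))
  have h2 := h1.const_mul ((b + 1) ^ k)
  rw [mul_zero] at h2
  filter_upwards [h2.eventually (gt_mem_nhds hc), eventually_ge_atTop 1] with n hn hn1
  have hn1' : (1 : ℝ) ≤ n := by exact_mod_cast hn1
  have h3 : (b * n + 1) ^ k ≤ (b + 1) ^ k * (n : ℝ) ^ k := by
    rw [← mul_pow]
    gcongr
    linarith
  have h4 : Real.exp (-(n : ℝ) * (2 * a)) = Real.exp (-a * n) * Real.exp (-(n : ℝ) * a) := by
    rw [← Real.exp_add]; congr 1; ring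
  simp only [Function.comp, Real.rpow_natCast] at hn
  rw [h4, ← mul_assoc]
  refine mul_le_mul_of_nonneg_right ?_ (Real.exp_pos _).le
  calc (b * n + 1) ^ k * Real.exp (-a * n) ≤ (b + 1) ^ k * (n : ℝ) ^ k * Real.exp (-a * n) := by
        gcongr
    _ ≤ c := by rw [mul_assoc]; exact hn.le

/-- A uniform law of large numbers with exponential tails for stable losses of pairs of members
of a class of finite pseudo-dimension. -/
theorem eventually_pi_pairLoss_deviation_le {𝕏 : Type u} [MeasurableSpace 𝕏] {Θ : Type v}
    {μ : Measure 𝕏} {f : Θ → 𝕏 → ℝ} (hfm : ∀ θ, Measurable (f θ))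
    (hf : ∀ θ x, f θ x ∈ Set.Icc (-1 : ℝ) 1) (hV : pseudoDim (Set.range f) < ⊤)
    (hsup : MeasurableSuprema μ f) {ρ : Measure (𝕏 × ℝ)} [IsProbabilityMeasure ρ]
    (hρ : ρ.fst = μ) {h : ℝ × ℝ × 𝕏 × ℝ → ℝ} (hh : IsStableLoss h) {t c : ℝ} (ht : 0 < t)
    (hc : 0 < c) :
    ∀ᶠ n : ℕ in atTop, (Measure.pi fun _ : Fin n => ρ)
        {z | ∃ p, t < |(1 / (n : ℝ)) * ∑ i, pairLoss h f p (z i) - ∫ x, pairLoss h f p x ∂ρ|} ≤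
      ENNReal.ofReal (c * Real.exp (-(n : ℝ) * (t ^ 2 / 4096))) := by
  obtain ⟨V, hV'⟩ := ENat.ne_top_iff_exists.1 hV.ne
  set K : ℝ := (⌊2 / (t / 64)⌋₊ + 2 : ℝ) with hK
  have hG : ∀ p, Measurable (pairLoss h f p) := fun p =>
    hh.measurable.comp (((hfm p.1).comp measurable_fst).prodMk
      (((hfm p.2).comp measurable_fst).prodMk (measurable_fst.prodMk measurable_snd)))
  have hlarge : ∀ᶠ n : ℕ in atTop, 8 * 4 ^ 2 / t ^ 2 ≤ (n : ℝ) :=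
    tendsto_natCast_atTop_atTop.eventually_ge_atTop _
  -- With M = 4 the rate t²/(128 M²) is twice t²/4096. The exponent `V * 2` comes from pairs, and
  -- c/4 cancels the factor 4 of the uniform law.
  filter_upwards [eventually_poly_mul_exp_le (a := t ^ 2 / 4096) (b := 2 * K) (c := c / 4)
    (by positivity) (by positivity) (by positivity) (V * 2), hlarge, eventually_ge_atTop 1]
    with n hn hn2 hn1
  refine (pi_uniform_deviation_le ρ hG (M := 4) (by norm_num) (fun p z => hh.bounded _) ht hn1 ?_
    (hsup.nullMeasurableSet_doubleSampleEvent hρ hh (by positivity))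
    (exists_pairLoss_cover hf hV'.ge hh ht)).trans (ENNReal.ofReal_le_ofReal ?_)
  · rwa [div_le_iff₀ (by positivity)] at hn2
  · have h1 : -(n : ℝ) * t ^ 2 / (128 * 4 ^ 2) = -(n : ℝ) * (2 * (t ^ 2 / 4096)) := by ring
    rw [h1, ← pow_mul]
    have h2 : (Fintype.card (Fin n ⊕ Fin n) * K + 1 : ℝ) = 2 * K * n + 1 := by
      simp; ring
    rw [h2]
    linarith

/-! ### The three losses and their means -/

noncomputable section

/-- Truncation of a real number to `[-1, 1]`. -/
def clip (a : ℝ) : ℝ := max (-1) (min 1 a)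

theorem clip_mem (a : ℝ) : clip a ∈ Set.Icc (-1 : ℝ) 1 :=
  ⟨le_max_left _ _, max_le (by norm_num) (min_le_left _ _)⟩

/-- Truncation keeps the losses bounded for all real arguments; on labels and values of the class it
does nothing. -/
theorem clip_of_mem {a : ℝ} (ha : a ∈ Set.Icc (-1 : ℝ) 1) : clip a = a := by
  rw [clip, min_eq_right ha.2, max_eq_right ha.1]

theorem measurable_clip : Measurable clip :=
  measurable_const.max (measurable_const.min measurable_id)

theorem abs_sub_le_two {a b : ℝ} (ha : a ∈ Set.Icc (-1 : ℝ) 1) (hb : b ∈ Set.Icc (-1 : ℝ) 1) :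
    |a - b| ≤ 2 := by
  rw [abs_le]; constructor <;> linarith [ha.1, ha.2, hb.1, hb.2]

theorem abs_mul_le_four {a b c d : ℝ} (ha : a ∈ Set.Icc (-1 : ℝ) 1) (hb : b ∈ Set.Icc (-1 : ℝ) 1)
    (hc : c ∈ Set.Icc (-1 : ℝ) 1) (hd : d ∈ Set.Icc (-1 : ℝ) 1) : |(a - b) * (c - d)| ≤ 4 := by
  rw [abs_mul]
  calc |a - b| * |c - d| ≤ 2 * 2 := by
        gcongr
        exacts [abs_sub_le_two ha hb, abs_sub_le_two hc hd]
    _ = 4 := by norm_num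

theorem label_mem (y : Label) : (y : ℝ) ∈ Set.Icc (-1 : ℝ) 1 := by
  rcases y.2 with h | h
  · rw [h]; norm_num
  · rw [Set.mem_singleton_iff.1 h]; norm_num

theorem measurable_signLabel : Measurable signLabel :=
  Measurable.ite measurableSet_Ici measurable_const measurable_const

/-- The product of the residual of the mark and the distance to `g`. -/
def residualLoss {𝕏 : Type u} (g : 𝕏 → ℝ) (w : ℝ × ℝ × 𝕏 × ℝ) : ℝ :=
  (clip w.2.2.2 - g w.2.2.1) * (clip w.1 - g w.2.2.1)

/-- The squared distance to `g`. -/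
def squareLoss {𝕏 : Type u} (g : 𝕏 → ℝ) (w : ℝ × ℝ × 𝕏 × ℝ) : ℝ :=
  (clip w.1 - g w.2.2.1) * (clip w.1 - g w.2.2.1)

/-- The product of the residual of an alternative output and the distance of two functions. -/
def signLoss {𝕏 : Type u} (w : ℝ × ℝ × 𝕏 × ℝ) : ℝ :=
  ((signLabel (w.1 + w.2.2.2) : ℝ) - clip w.1) * (clip w.2.1 - clip w.1)

theorem isStableLoss_residualLoss {𝕏 : Type u} [MeasurableSpace 𝕏] {g : 𝕏 → ℝ}
    (hg : Measurable g) (hg1 : ∀ x, g x ∈ Set.Icc (-1 : ℝ) 1) : IsStableLoss (residualLoss g) where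
  measurable := by
    have := measurable_clip
    unfold residualLoss
    fun_prop
  bounded w := abs_mul_le_four (clip_mem _) (hg1 _) (clip_mem _) (hg1 _)
  stable a a' b b' η x v ha ha' hb hb' h1 h2 _ := by
    simp only [residualLoss, clip_of_mem ha, clip_of_mem ha']
    rw [← mul_sub, sub_sub_sub_cancel_right, abs_mul]
    have := abs_sub_le_two (clip_mem v) (hg1 x)
    have h0 := abs_nonneg (a - a')
    nlinarith [abs_nonneg (clip v - g x)]

theorem isStableLoss_squareLoss {𝕏 : Type u} [MeasurableSpace 𝕏] {g : 𝕏 → ℝ}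
    (hg : Measurable g) (hg1 : ∀ x, g x ∈ Set.Icc (-1 : ℝ) 1) : IsStableLoss (squareLoss g) where
  measurable := by
    have := measurable_clip
    unfold squareLoss
    fun_prop
  bounded w := abs_mul_le_four (clip_mem _) (hg1 _) (clip_mem _) (hg1 _)
  stable a a' b b' η x v ha ha' hb hb' h1 h2 _ := by
    simp only [squareLoss, clip_of_mem ha, clip_of_mem ha']
    have h3 : (a - g x) * (a - g x) - (a' - g x) * (a' - g x) =
        ((a - g x) + (a' - g x)) * (a - a') := by ring
    rw [h3, abs_mul]
    have h4 := abs_add_le (a - g x) (a' - g x)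
    have h5 := abs_sub_le_two ha (hg1 x)
    have h6 := abs_sub_le_two ha' (hg1 x)
    have h0 := abs_nonneg (a - a')
    nlinarith [abs_nonneg ((a - g x) + (a' - g x))]

/-- With both values on the same side of -v the sign is frozen, and the rest is Lipschitz. The
convention sign 0 = +1 matches the non-strict inequality in the subgraph. -/
theorem isStableLoss_signLoss {𝕏 : Type u} [MeasurableSpace 𝕏] :
    IsStableLoss (signLoss (𝕏 := 𝕏)) where
  measurable := by
    have := measurable_clip
    have h2 : Measurable fun w : ℝ × ℝ × 𝕏 × ℝ => (signLabel (w.1 + w.2.2.2) : ℝ) :=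
      measurable_subtype_coe.comp (measurable_signLabel.comp (by fun_prop))
    unfold signLoss
    fun_prop
  bounded w := abs_mul_le_four (label_mem _) (clip_mem _) (clip_mem _) (clip_mem _)
  stable a a' b b' η x v ha ha' hb hb' h1 h2 h3 := by
    have hs : signLabel (a + v) = signLabel (a' + v) := by
      have : 0 ≤ a + v ↔ 0 ≤ a' + v := by
        rw [← neg_le_iff_add_nonneg, ← neg_le_iff_add_nonneg]; exact h3
      simp only [signLabel, this]
    simp only [signLoss, clip_of_mem ha, clip_of_mem ha', clip_of_mem hb, clip_of_mem hb', hs]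
    set s : ℝ := (signLabel (a' + v) : ℝ) with hsdef
    have h4 : (s - a) * (b - a) - (s - a') * (b' - a') =
        (s - a) * ((b - b') - (a - a')) - (a - a') * (b' - a') := by ring
    rw [h4]
    have h5 := abs_sub_le_two (hsdef ▸ label_mem (signLabel (a' + v)) : s ∈ Set.Icc (-1 : ℝ) 1) ha
    have h6 := abs_sub_le_two hb' ha'
    have h7 : |(b - b') - (a - a')| ≤ 2 * η := (abs_sub _ _).trans (by linarith)
    have h8 : |(s - a) * ((b - b') - (a - a'))| ≤ 2 * (2 * η) := by
      rw [abs_mul]; gcongr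
    have h9 : |(a - a') * (b' - a')| ≤ η * 2 := by
      rw [abs_mul]
      have := abs_nonneg (a - a')
      gcongr
      linarith
    have h0 := abs_nonneg (a - a')
    exact (abs_sub _ _).trans (by linarith)

/-- The uniform distribution on `[-1, 1]`. -/
abbrev uniformNoise : Measure ℝ := ProbabilityTheory.cond (volume : Measure ℝ) (Set.Icc (-1) 1)

instance : IsProbabilityMeasure uniformNoise :=
  cond_isProbabilityMeasure_of_finite (by simp [Real.volume_Icc]) (by simp [Real.volume_Icc])

/-- The output is +1 exactly when v ≥ -a, which has probability (1 + a)/2. Thus a candidate is the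
regression function of its own alternative samples. -/
theorem integral_signLabel_add {a : ℝ} (ha : a ∈ Set.Icc (-1 : ℝ) 1) :
    ∫ v, (signLabel (a + v) : ℝ) ∂uniformNoise = a := by
  have h1 : ∀ v, (signLabel (a + v) : ℝ) = 2 * (Set.Ici (-a)).indicator (fun _ => (1 : ℝ)) v - 1 := by
    intro v
    by_cases h : 0 ≤ a + v
    · have : v ∈ Set.Ici (-a) := by simp; linarith
      simp [signLabel, h, this]; norm_num
    · have : v ∉ Set.Ici (-a) := by simp; linarith
      simp [signLabel, h, this]
  have h2 : uniformNoise.real (Set.Ici (-a)) = (1 + a) / 2 := by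
    rw [measureReal_def, cond_apply measurableSet_Icc]
    have : Set.Icc (-1 : ℝ) 1 ∩ Set.Ici (-a) = Set.Icc (-a) 1 := by
      ext v
      simp only [Set.mem_inter_iff, Set.mem_Icc, Set.mem_Ici]
      constructor
      · rintro ⟨⟨h1, h2⟩, h3⟩; exact ⟨h3, h2⟩
      · rintro ⟨h1, h2⟩; exact ⟨⟨by linarith [ha.2], h2⟩, h1⟩
    rw [this, Real.volume_Icc, Real.volume_Icc, ENNReal.toReal_mul, ENNReal.toReal_inv,
      ENNReal.toReal_ofReal (by norm_num), ENNReal.toReal_ofReal (by linarith [ha.1])]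
    ring
  simp_rw [h1]
  rw [integral_sub, integral_const_mul, integral_indicator_const _ measurableSet_Ici, h2]
  · simp; ring
  · exact ((integrable_const _).indicator measurableSet_Ici).const_mul _
  · exact integrable_const _

theorem integral_signLoss_eq_zero {𝕏 : Type u} [MeasurableSpace 𝕏] {Θ : Type v} (μ : Measure 𝕏)
    [IsProbabilityMeasure μ] {f : Θ → 𝕏 → ℝ} (hfm : ∀ θ, Measurable (f θ))
    (hf : ∀ θ x, f θ x ∈ Set.Icc (-1 : ℝ) 1) (p : Θ × Θ) :
    ∫ z, pairLoss signLoss f p z ∂(μ.prod uniformNoise) = 0 := by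
  have hm : Measurable (pairLoss signLoss f p) :=
    isStableLoss_signLoss.measurable.comp (((hfm p.1).comp measurable_fst).prodMk
      (((hfm p.2).comp measurable_fst).prodMk (measurable_fst.prodMk measurable_snd)))
  have hint : Integrable (pairLoss signLoss f p) (μ.prod uniformNoise) :=
    Integrable.of_bound hm.aestronglyMeasurable 4
      (ae_of_all _ fun z => isStableLoss_signLoss.bounded _)
  rw [integral_prod _ hint]
  refine integral_eq_zero_of_ae (ae_of_all _ fun x => ?_)
  simp only [pairLoss, signLoss, clip_of_mem (hf _ _), Pi.zero_apply]
  rw [integral_mul_const, integral_sub, integral_signLabel_add (hf _ _)]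
  · simp
  · refine Integrable.of_bound (Measurable.aestronglyMeasurable ?_) 1
      (ae_of_all _ fun v => abs_le.2 (label_mem _))
    exact measurable_subtype_coe.comp (measurable_signLabel.comp (by fun_prop))
  · exact integrable_const _

/-- The law of an input with its output as a real mark. -/
def markedLaw {𝕏 : Type u} [MeasurableSpace 𝕏] (Q : Measure (𝕏 × Label)) : Measure (𝕏 × ℝ) :=
  Q.map fun p => (p.1, (p.2 : ℝ))

theorem measurable_mark {𝕏 : Type u} [MeasurableSpace 𝕏] :
    Measurable fun p : 𝕏 × Label => (p.1, (p.2 : ℝ)) :=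
  measurable_fst.prodMk (measurable_subtype_coe.comp measurable_snd)

instance {𝕏 : Type u} [MeasurableSpace 𝕏] (Q : Measure (𝕏 × Label)) [IsProbabilityMeasure Q] :
    IsProbabilityMeasure (markedLaw Q) :=
  Measure.isProbabilityMeasure_map measurable_mark.aemeasurable

theorem markedLaw_fst {𝕏 : Type u} [MeasurableSpace 𝕏] (Q : Measure (𝕏 × Label)) :
    (markedLaw Q).fst = Q.fst := by
  rw [Measure.fst, markedLaw, Measure.map_map measurable_fst measurable_mark]
  rfl

/-- The residual of the regression function is orthogonal to bounded functions of the input: such a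
factor comes out of the conditional expectation. -/
theorem integral_residualLoss_eq_zero {𝕏 : Type u} [MeasurableSpace 𝕏] {Θ : Type v}
    (Q : Measure (𝕏 × Label)) [IsProbabilityMeasure Q] {f : Θ → 𝕏 → ℝ}
    (hfm : ∀ θ, Measurable (f θ)) (hf : ∀ θ x, f θ x ∈ Set.Icc (-1 : ℝ) 1) {θs : Θ}
    (hreg : IsRegressionFunction Q (f θs)) (p : Θ × Θ) :
    ∫ z, pairLoss (residualLoss (f θs)) f p z ∂(markedLaw Q) = 0 := by
  have hst := isStableLoss_residualLoss (hfm θs) (hf θs)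
  have hm : Measurable (pairLoss (residualLoss (f θs)) f p) :=
    hst.measurable.comp (((hfm p.1).comp measurable_fst).prodMk
      (((hfm p.2).comp measurable_fst).prodMk (measurable_fst.prodMk measurable_snd)))
  rw [markedLaw, integral_map measurable_mark.aemeasurable hm.aestronglyMeasurable]
  simp only [pairLoss, residualLoss, clip_of_mem (hf _ _), clip_of_mem (label_mem _)]
  set k : 𝕏 × Label → ℝ := fun z => f p.1 z.1 - f θs z.1 with hk
  have hkm : StronglyMeasurable[MeasurableSpace.comap Prod.fst inferInstance] k := by
    refine Measurable.stronglyMeasurable ?_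
    exact ((hfm p.1).sub (hfm θs)).comp (comap_measurable Prod.fst)
  have hkm' : Measurable k := ((hfm p.1).sub (hfm θs)).comp measurable_fst
  have hY : Integrable (fun z : 𝕏 × Label => (z.2 : ℝ)) Q :=
    Integrable.of_bound (measurable_subtype_coe.comp measurable_snd).aestronglyMeasurable 1
      (ae_of_all _ fun v => abs_le.2 (label_mem _))
  have hYk : Integrable ((fun z : 𝕏 × Label => (z.2 : ℝ)) * k) Q :=
    hY.mul_bdd (c := 2) hkm'.aestronglyMeasurable
      (ae_of_all _ fun z => abs_sub_le_two (hf _ _) (hf _ _))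
  have hgk : Integrable (fun z : 𝕏 × Label => f θs z.1 * k z) Q := by
    refine Integrable.of_bound
      (((hfm θs).comp measurable_fst).mul hkm').aestronglyMeasurable 2 (ae_of_all _ fun z => ?_)
    have h1 := abs_sub_le_two (hf p.1 z.1) (hf θs z.1)
    have h2 := abs_le.2 (hf θs z.1)
    rw [Real.norm_eq_abs, abs_mul]
    calc |f θs z.1| * |k z| ≤ 1 * 2 := by gcongr
      _ = 2 := by norm_num
  have h1 := condExp_mul_of_stronglyMeasurable_right (μ := Q) hkm hYk hY
  have h2 : ∫ z, (z.2 : ℝ) * k z ∂Q = ∫ z, f θs z.1 * k z ∂Q := by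
    have h3 := integral_condExp measurable_fst.comap_le (μ := Q) (f := (fun z : 𝕏 × Label => (z.2 : ℝ)) * k)
    simp only [Pi.mul_apply] at h3
    rw [← h3]
    refine integral_congr_ae ?_
    filter_upwards [h1, hreg.2] with z hz hz2
    rw [hz, Pi.mul_apply, hz2]
  have h3 : ∀ z : 𝕏 × Label, ((z.2 : ℝ) - f θs z.1) * (f p.1 z.1 - f θs z.1) =
      (z.2 : ℝ) * k z - f θs z.1 * k z := fun z => sub_mul _ _ _
  simp_rw [h3]
  exact (integral_sub hYk hgk).trans (sub_eq_zero.2 h2)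

theorem integral_squareLoss {𝕏 : Type u} [MeasurableSpace 𝕏] {Θ : Type v}
    (Q : Measure (𝕏 × Label)) {f : Θ → 𝕏 → ℝ}
    (hfm : ∀ θ, Measurable (f θ)) (hf : ∀ θ x, f θ x ∈ Set.Icc (-1 : ℝ) 1) (θs : Θ)
    (p : Θ × Θ) :
    ∫ z, pairLoss (squareLoss (f θs)) f p z ∂(markedLaw Q) =
      ∫ x, (f p.1 x - f θs x) ^ 2 ∂Q.fst := by
  have hm : Measurable fun x => (f p.1 x - f θs x) ^ 2 := ((hfm p.1).sub (hfm θs)).pow_const 2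
  rw [← markedLaw_fst, Measure.fst, integral_map measurable_fst.aemeasurable
    hm.aestronglyMeasurable]
  simp only [pairLoss, squareLoss, clip_of_mem (hf _ _), sq]

end

/-! ### The deterministic rank argument -/

noncomputable section

/-- The basic inequality of empirical risk minimization. -/
theorem refVar_le_two_mul_abs {𝕏 : Type u} {Θ : Type v} {n : ℕ} {f : Θ → 𝕏 → ℝ}
    {est : (n : ℕ) → (Fin n → 𝕏 × Label) → Θ} {D : Fin n → 𝕏 × Label} {θ : Θ}
    (h : empRisk D (f (est n D)) ≤ empRisk D (f θ)) :
    refVar f est θ D ≤ 2 * |(1 / (n : ℝ)) * ∑ i, (((D i).2 : ℝ) - f θ (D i).1) *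
      (f (est n D) (D i).1 - f θ (D i).1)| := by
  -- Write f̂ - y = (f̂ - f_θ) - (y - f_θ) and expand the square.
  have h1 : empRisk D (f (est n D)) - empRisk D (f θ) = refVar f est θ D -
      2 * ((1 / (n : ℝ)) * ∑ i, (((D i).2 : ℝ) - f θ (D i).1) *
        (f (est n D) (D i).1 - f θ (D i).1)) := by
    simp only [empRisk, refVar]
    rw [← mul_sub, mul_left_comm, ← mul_sub]
    congr 1
    rw [Finset.mul_sum, ← Finset.sum_sub_distrib, ← Finset.sum_sub_distrib]
    refine Finset.sum_congr rfl fun i _ => ?_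
    ring
  have h2 := le_abs_self ((1 / (n : ℝ)) * ∑ i, (((D i).2 : ℝ) - f θ (D i).1) *
      (f (est n D) (D i).1 - f θ (D i).1))
  linarith

/-- This is (a - c)² ≤ 2(a - b)² + 2(b - c)², averaged over the inputs, with f̂ as the middle point
b. -/
theorem half_sub_refVar_le_refVar {𝕏 : Type u} {Θ : Type v} {n : ℕ} (f : Θ → 𝕏 → ℝ)
    (est : (n : ℕ) → (Fin n → 𝕏 × Label) → Θ) (D : Fin n → 𝕏 × Label) (θ θs : Θ) :
    (1 / 2) * ((1 / (n : ℝ)) * ∑ i, (f θ (D i).1 - f θs (D i).1) ^ 2) - refVar f est θs D ≤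
      refVar f est θ D := by
  simp only [refVar]
  rw [mul_left_comm, ← mul_sub, Finset.mul_sum, ← Finset.sum_sub_distrib]
  refine mul_le_mul_of_nonneg_left (Finset.sum_le_sum fun i _ => ?_) (by positivity)
  nlinarith [sq_nonneg (f θ (D i).1 - 2 * f (est n D) (D i).1 + f θs (D i).1)]

/-- The event of a large deviation of the average loss of some pair from its mean. -/
def deviationEvent {𝕏 : Type u} [MeasurableSpace 𝕏] {Θ : Type v} (f : Θ → 𝕏 → ℝ)
    (h : ℝ × ℝ × 𝕏 × ℝ → ℝ) (ρ : Measure (𝕏 × ℝ)) (n : ℕ) (t : ℝ) : Set (Fin n → 𝕏 × ℝ) :=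
  {z | ∃ p, t < |(1 / (n : ℝ)) * ∑ i, pairLoss h f p (z i) - ∫ x, pairLoss h f p x ∂ρ|}

/-- Without large deviations, every parameter outside of the ball has the largest possible rank. -/
theorem rank_eq_of_notMem_deviationEvent {𝕏 : Type u} [MeasurableSpace 𝕏] {Θ : Type v}
    [MetricSpace Θ] (Q : Measure (𝕏 × Label)) [IsProbabilityMeasure Q] {f : Θ → 𝕏 → ℝ}
    (hfm : ∀ θ, Measurable (f θ)) (hf : ∀ θ x, f θ x ∈ Set.Icc (-1 : ℝ) 1) {θs : Θ}
    (hreg : IsRegressionFunction Q (f θs)) {L : ℝ} (hL : 0 < L)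
    (hdist : ∀ θ₁ θ₂ : Θ, dist θ₁ θ₂ ≤ L * l2dist Q.fst (f θ₁) (f θ₂))
    {est : (n : ℕ) → (Fin n → 𝕏 × Label) → Θ} (hest : IsERM f est) {ε t : ℝ} (hε : 0 < ε)
    (ht : t = ε ^ 2 / (10 * L ^ 2)) {n r : ℕ} (D : Fin n → 𝕏 × Label) (U : Fin n × Fin r → ℝ)
    (π : Equiv.Perm (Fin (r + 1)))
    (hA : (fun i => ((D i).1, ((D i).2 : ℝ))) ∉
      deviationEvent f (residualLoss (f θs)) (markedLaw Q) n t)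
    (hC : (fun i => ((D i).1, ((D i).2 : ℝ))) ∉
      deviationEvent f (squareLoss (f θs)) (markedLaw Q) n t)
    (hB : ∀ j, (fun i => ((D i).1, U (i, j))) ∉
      deviationEvent f signLoss (Q.fst.prod uniformNoise) n t)
    {θ : Θ} (hθ : θ ∉ Metric.ball θs ε) :
    rank f est D U π θ = r + 1 := by
  have ht0 : 0 < t := by rw [ht]; positivity
  simp only [deviationEvent, Set.mem_ofPred_eq, not_exists, not_lt] at hA hC hB
  have hs : refVar f est θs D ≤ 2 * t := by
    refine (refVar_le_two_mul_abs ((hest n).1 D θs)).trans ?_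
    have h := hA (est n D, θs)
    rw [integral_residualLoss_eq_zero Q hfm hf hreg, sub_zero] at h
    simp only [pairLoss, residualLoss, clip_of_mem (hf _ _), clip_of_mem (label_mem _)] at h
    linarith
  have hfar : 10 * t ≤ ∫ x, (f θ x - f θs x) ^ 2 ∂Q.fst := by
    have h1 : ε ≤ L * l2dist Q.fst (f θ) (f θs) :=
      (not_lt.1 fun h => hθ (Metric.mem_ball.2 h)).trans (hdist θ θs)
    have h2 : ε / L ≤ l2dist Q.fst (f θ) (f θs) := by rwa [div_le_iff₀' hL]
    have h3 := Real.le_sqrt' (by positivity : 0 < ε / L) |>.1 h2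
    refine le_trans (le_of_eq ?_) h3
    rw [ht]; field_simp
  have h0 : (5 / 2) * t ≤ refVar f est θ D := by
    have h := hC (θ, θs)
    rw [integral_squareLoss Q hfm hf] at h
    simp only [pairLoss, squareLoss, clip_of_mem (hf _ _), ← sq] at h
    have h1 := (abs_le.1 h).1
    have h2 := half_sub_refVar_le_refVar f est D θ θs
    linarith
  have hj : ∀ j, refVar f est θ (altSample (f θ) D fun i => U (i, j)) ≤ 2 * t := by
    intro j
    refine (refVar_le_two_mul_abs ((hest n).1 _ θ)).trans ?_
    -- The minimizer depends on θ and on the noise, so the bound must hold for all pairs on one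
    -- event.
    have h := hB j (θ, est n (altSample (f θ) D fun i => U (i, j)))
    rw [integral_signLoss_eq_zero Q.fst hfm hf, sub_zero] at h
    simp only [pairLoss, signLoss, clip_of_mem (hf _ _)] at h
    simp only [altSample] at h ⊢
    linarith
  -- The gap between 2t and 5t/2 makes every comparison strict, so ties play no role.
  rw [rank, Finset.sum_congr rfl fun j _ => if_pos (Or.inl ((hj j).trans_lt (by linarith)))]
  simp [add_comm]

/-! ### Transfer to the joint law and union bound -/

theorem measurePreserving_comp_injective {ι κ Z : Type*} [Fintype ι] [Fintype κ]
    [MeasurableSpace Z] (ρ : Measure Z) [IsProbabilityMeasure ρ] {e : κ → ι}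
    (he : Function.Injective e) :
    MeasurePreserving (fun (z : ι → Z) k => z (e k)) (Measure.pi fun _ : ι => ρ)
      (Measure.pi fun _ : κ => ρ) := by
  have h1 : iIndepFun (fun i (z : ι → Z) => z i) (Measure.pi fun _ : ι => ρ) :=
    iIndepFun_pi (μ := fun _ : ι => ρ) (X := fun _ => id) fun _ => aemeasurable_id
  have h2 := (iIndepFun_iff_map_fun_eq_pi_map
    fun k => (measurable_pi_apply (e k)).aemeasurable).1 (h1.precomp he)
  refine ⟨by fun_prop, h2.trans ?_⟩
  congr 1
  funext k
  exact (measurePreserving_eval (fun _ : ι => ρ) (e k)).map_eq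

instance (r : ℕ) :
    IsProbabilityMeasure (uniformOn (Set.univ : Set (Equiv.Perm (Fin (r + 1))))) :=
  isProbabilityMeasure_uniformOn Set.finite_univ Set.univ_nonempty

theorem measurePreserving_markedSample {𝕏 : Type u} [MeasurableSpace 𝕏] (Q : Measure (𝕏 × Label))
    [IsProbabilityMeasure Q] (n r : ℕ) :
    MeasurePreserving (fun (w : (Fin n → 𝕏 × Label) × (Fin n × Fin r → ℝ) ×
        Equiv.Perm (Fin (r + 1))) i => ((w.1 i).1, ((w.1 i).2 : ℝ)))
      (jointLaw Q n r) (Measure.pi fun _ : Fin n => markedLaw Q) :=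
  (measurePreserving_pi (fun _ : Fin n => Q) (fun _ => markedLaw Q)
    fun _ => ⟨measurable_mark, rfl⟩).comp measurePreserving_fst

theorem measurePreserving_noiseSample {𝕏 : Type u} [MeasurableSpace 𝕏] (Q : Measure (𝕏 × Label))
    [IsProbabilityMeasure Q] (n r : ℕ) (j : Fin r) :
    MeasurePreserving (fun (w : (Fin n → 𝕏 × Label) × (Fin n × Fin r → ℝ) ×
        Equiv.Perm (Fin (r + 1))) i => ((w.1 i).1, w.2.1 (i, j)))
      (jointLaw Q n r) (Measure.pi fun _ : Fin n => Q.fst.prod uniformNoise) := by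
  have h1 : MeasurePreserving (fun (D : Fin n → 𝕏 × Label) i => (D i).1)
      (Measure.pi fun _ => Q) (Measure.pi fun _ => Q.fst) :=
    measurePreserving_pi (fun _ : Fin n => Q) (fun _ => Q.fst) fun _ => ⟨measurable_fst, rfl⟩
  have h2 : MeasurePreserving (fun (U : Fin n × Fin r → ℝ) i => U (i, j))
      (Measure.pi fun _ => uniformNoise) (Measure.pi fun _ => uniformNoise) :=
    measurePreserving_comp_injective uniformNoise fun _ _ h => (Prod.mk.inj h).1
  have h3 : MeasurePreserving Prod.fst
      ((Measure.pi fun _ : Fin n × Fin r => uniformNoise).prod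
        (uniformOn (Set.univ : Set (Equiv.Perm (Fin (r + 1))))))
      (Measure.pi fun _ => uniformNoise) := measurePreserving_fst
  have h4 := (measurePreserving_arrowProdEquivProdArrow 𝕏 ℝ (Fin n) (fun _ => Q.fst)
    fun _ => uniformNoise).symm
  exact h4.comp (h1.prod (h2.comp h3))

/-- For possibly nonmeasurable sets equality can fail, but this direction suffices for outer
probabilities. -/
theorem measure_preimage_le_of_measurePreserving {α β : Type*} [MeasurableSpace α]
    [MeasurableSpace β] {μ : Measure α} {ν : Measure β} {g : α → β} (hg : MeasurePreserving g μ ν)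
    (s : Set β) : μ (g ⁻¹' s) ≤ ν s :=
  (Measure.le_map_apply hg.measurable.aemeasurable s).trans (by rw [hg.map_eq])

/-- Exponential decay of the outer probability that the region is not contained in a ball. -/
theorem eventually_measure_region_not_subset_le {𝕏 : Type u} [MeasurableSpace 𝕏] {Θ : Type v}
    [MetricSpace Θ] (Q : Measure (𝕏 × Label)) [IsProbabilityMeasure Q] {f : Θ → 𝕏 → ℝ}
    (hfm : ∀ θ, Measurable (f θ)) (hf : ∀ θ x, f θ x ∈ Set.Icc (-1 : ℝ) 1) {θs : Θ}
    (hreg : IsRegressionFunction Q (f θs)) {L : ℝ} (hL : 0 < L)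
    (hdist : ∀ θ₁ θ₂ : Θ, dist θ₁ θ₂ ≤ L * l2dist Q.fst (f θ₁) (f θ₂))
    (hV : pseudoDim (Set.range f) < ⊤) (hsup : MeasurableSuprema Q.fst f)
    {est : (n : ℕ) → (Fin n → 𝕏 × Label) → Θ} (hest : IsERM f est) {r q : ℕ} (hq : q < r + 1)
    {ε : ℝ} (hε : 0 < ε) :
    ∀ᶠ n : ℕ in atTop, jointLaw Q n r {w | ¬ region f est q w.1 w.2.1 w.2.2 ⊆ Metric.ball θs ε} ≤
      ENNReal.ofReal (Real.exp (-(n : ℝ) * ((ε ^ 2 / (10 * L ^ 2)) ^ 2 / 4096))) := by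
  set t := ε ^ 2 / (10 * L ^ 2) with ht
  have ht0 : 0 < t := by positivity
  -- There are r + 2 bad events: two for the original sample and one per alternative sample. The
  -- total prefactor becomes 1.
  set c : ℝ := 1 / (r + 2) with hc
  have hc0 : 0 < c := by positivity
  filter_upwards [
    eventually_pi_pairLoss_deviation_le hfm hf hV hsup (markedLaw_fst Q)
      (isStableLoss_residualLoss (hfm θs) (hf θs)) ht0 hc0,
    eventually_pi_pairLoss_deviation_le hfm hf hV hsup (markedLaw_fst Q)
      (isStableLoss_squareLoss (hfm θs) (hf θs)) ht0 hc0,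
    eventually_pi_pairLoss_deviation_le hfm hf hV hsup
      (ρ := Q.fst.prod uniformNoise) Measure.fst_prod isStableLoss_signLoss ht0 hc0]
    with n hA hC hB
  set x := c * Real.exp (-(n : ℝ) * (t ^ 2 / 4096)) with hx
  have hx0 : 0 ≤ x := by positivity
  set W := (Fin n → 𝕏 × Label) × (Fin n × Fin r → ℝ) × Equiv.Perm (Fin (r + 1))
  set gD : W → Fin n → 𝕏 × ℝ := fun w i => ((w.1 i).1, ((w.1 i).2 : ℝ)) with hgD
  set gU : Fin r → W → Fin n → 𝕏 × ℝ := fun j w i => ((w.1 i).1, w.2.1 (i, j)) with hgU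
  set EA := gD ⁻¹' deviationEvent f (residualLoss (f θs)) (markedLaw Q) n t with hEA
  set EC := gD ⁻¹' deviationEvent f (squareLoss (f θs)) (markedLaw Q) n t with hEC
  set EB : Fin r → Set W := fun j =>
    gU j ⁻¹' deviationEvent f signLoss (Q.fst.prod uniformNoise) n t with hEB
  have hsub : {w : W | ¬ region f est q w.1 w.2.1 w.2.2 ⊆ Metric.ball θs ε} ⊆
      (EA ∪ EC) ∪ ⋃ j, EB j := by
    intro w hw
    by_contra hnot
    simp only [Set.mem_union, Set.mem_iUnion, not_or, not_exists] at hnot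
    refine hw fun θ hθ => ?_
    by_contra hball
    have hrank := rank_eq_of_notMem_deviationEvent Q hfm hf hreg hL hdist hest hε ht w.1 w.2.1
      w.2.2 hnot.1.1 hnot.1.2 hnot.2 hball
    have hle : rank f est w.1 w.2.1 w.2.2 θ ≤ q := hθ
    omega
  have hmA : jointLaw Q n r EA ≤ ENNReal.ofReal x :=
    (measure_preimage_le_of_measurePreserving (measurePreserving_markedSample Q n r) _).trans hA
  have hmC : jointLaw Q n r EC ≤ ENNReal.ofReal x :=
    (measure_preimage_le_of_measurePreserving (measurePreserving_markedSample Q n r) _).trans hC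
  have hmB : ∀ j, jointLaw Q n r (EB j) ≤ ENNReal.ofReal x := fun j =>
    (measure_preimage_le_of_measurePreserving (measurePreserving_noiseSample Q n r j) _).trans hB
  calc _ ≤ jointLaw Q n r ((EA ∪ EC) ∪ ⋃ j, EB j) := measure_mono hsub
    _ ≤ (jointLaw Q n r EA + jointLaw Q n r EC) + ∑ j, jointLaw Q n r (EB j) :=
        (measure_union_le _ _).trans
          (add_le_add (measure_union_le _ _) (measure_iUnion_fintype_le _ _))
    _ ≤ (ENNReal.ofReal x + ENNReal.ofReal x) + ∑ _j : Fin r, ENNReal.ofReal x := by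
        gcongr with j
        exact hmB j
    _ = ENNReal.ofReal ((r + 2) * x) := by
        rw [Finset.sum_const, Finset.card_univ, Fintype.card_fin, nsmul_eq_mul,
          ← ENNReal.ofReal_add hx0 hx0, ← ENNReal.ofReal_natCast,
          ← ENNReal.ofReal_mul (by positivity), ← ENNReal.ofReal_add (by positivity)
          (by positivity)]
        congr 1
        ring
    _ = _ := by
        congr 1
        rw [hx, hc]
        field_simp

end

end ERMRegion

/-! ### The main theorem -/

theorem theorem3 :
    ∃ (C₁ : ℝ → ℕ∞ → ℝ) (lam₁ : ℝ → ℝ → ℝ),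
      (∀ ε L : ℝ, 0 < ε → 0 < L → 0 < lam₁ ε L) ∧
      ∀ (d : ℕ) (S : Set (EuclideanSpace ℝ (Fin d)))
        (Q : Measure (↥S × ERMRegion.Label)) [IsProbabilityMeasure Q]
        (Θ : Type u) [MetricSpace Θ] (f : Θ → ↥S → ℝ) (θs : Θ) (L : ℝ)
        (est : (n : ℕ) → (Fin n → ↥S × ERMRegion.Label) → Θ) (r q : ℕ),
        -- the model class consists of measurable functions with values in `[-1, 1]`
        (∀ θ, Measurable (f θ)) →
        (∀ θ x, f θ x ∈ Set.Icc (-1 : ℝ) 1) →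
        -- it contains the regression function, whose parameter is `θs`
        ERMRegion.IsRegressionFunction Q (f θs) →
        -- the parameterization is injective in `L₂`
        (∀ θ₁ θ₂ : Θ, θ₁ ≠ θ₂ → ∫ x, (f θ₁ x - f θ₂ x) ^ 2 ∂Q.fst ≠ 0) →
        -- it is inverse Lipschitz with constant `L`
        0 < L →
        (∀ θ₁ θ₂ : Θ, dist θ₁ θ₂ ≤ L * ERMRegion.l2dist Q.fst (f θ₁) (f θ₂)) →
        -- the class has finite pseudo-dimension
        ERMRegion.pseudoDim (Set.range f) < ⊤ →
        -- suprema over the class are measurable, and empirical risk minimizers exist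
        ERMRegion.MeasurableSuprema Q.fst f →
        ERMRegion.IsERM f est →
        -- the region is given by `q < m`, where `m = r + 1` is the number of samples
        q < r + 1 →
        ∀ ε : ℝ, 0 < ε → ∃ N₀ : ℕ, ∀ n : ℕ, N₀ ≤ n →
          ∀ (Ω : Type v) [MeasurableSpace Ω] (P : Measure Ω) [IsProbabilityMeasure P]
            (D : Ω → Fin n → ↥S × ERMRegion.Label) (U : Ω → Fin n × Fin r → ℝ)
            (π : Ω → Equiv.Perm (Fin (r + 1))),
            HasLaw (fun ω => (D ω, U ω, π ω)) (ERMRegion.jointLaw Q n r) P →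
            1 - C₁ ε (ERMRegion.pseudoDim (Set.range f)) * Real.exp (-(n : ℝ) * lam₁ ε L) ≤
                P.real {ω | ERMRegion.region f est q (D ω) (U ω) (π ω) ⊆ Metric.ball θs ε} ∧
              P.real {ω | ¬ ERMRegion.region f est q (D ω) (U ω) (π ω) ⊆ Metric.ball θs ε} ≤
                C₁ ε (ERMRegion.pseudoDim (Set.range f)) * Real.exp (-(n : ℝ) * lam₁ ε L) := by
  -- All prefactors are absorbed by N₀, which may depend on Q, the class and r, so C₁ = 1 works.
  refine ⟨fun _ _ => 1, fun ε L => (ε ^ 2 / (10 * L ^ 2)) ^ 2 / 4096,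
    fun ε L hε hL => by positivity, ?_⟩
  intro d S Q _ Θ _ f θs L est r q hfm hf hreg _ hL hdist hV hsup hest hq ε hε
  obtain ⟨N₀, hN₀⟩ := Filter.eventually_atTop.1
    (ERMRegion.eventually_measure_region_not_subset_le Q hfm hf hreg hL hdist hV hsup hest hq hε)
  refine ⟨N₀, fun n hn Ω _ P _ D U π hlaw => ?_⟩
  have hbad : P.real {ω | ¬ ERMRegion.region f est q (D ω) (U ω) (π ω) ⊆ Metric.ball θs ε} ≤
      1 * Real.exp (-(n : ℝ) * ((ε ^ 2 / (10 * L ^ 2)) ^ 2 / 4096)) := by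
    rw [one_mul]
    refine ENNReal.toReal_le_of_le_ofReal (Real.exp_pos _).le ?_
    refine le_trans ?_ (hN₀ n hn)
    rw [← hlaw.map_eq]
    exact Measure.le_map_apply hlaw.aemeasurable
      {w | ¬ ERMRegion.region f est q w.1 w.2.1 w.2.2 ⊆ Metric.ball θs ε}
  refine ⟨?_, hbad⟩
  -- Subadditivity gives the lower bound even if the event is not measurable.
  have hunion := measureReal_union_le (μ := P)
    {ω | ERMRegion.region f est q (D ω) (U ω) (π ω) ⊆ Metric.ball θs ε}
    {ω | ERMRegion.region f est q (D ω) (U ω) (π ω) ⊆ Metric.ball θs ε}ᶜ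
  rw [Set.union_compl_self, probReal_univ] at hunion
  have hcompl : {ω | ERMRegion.region f est q (D ω) (U ω) (π ω) ⊆ Metric.ball θs ε}ᶜ =
      {ω | ¬ ERMRegion.region f est q (D ω) (U ω) (π ω) ⊆ Metric.ball θs ε} := rfl
  rw [hcompl] at hunion
  linarith
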